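/- Let $k$ be a field and $X$ a well-ordered set; let $X^*$ be the free monoid on $X$, $k\langle X\rangle$ the free associative algebra, and $\mathrm{Lie}(X)\subset k\langle X\rangle$ the Lie subalgebra generated by $X$ under $[p,q]=pq-qp$. Lexicographic order on $X^*$: $1\succ v$ for $v\ne 1$, and $xu_1\succ yv_1$ iff $x>y$, or $x=y$ and $u_1\succ v_1$. Deg-lex order: $u>v$ iff $|u|>|v|$, or $|u|=|v|$ and $u\succ v$. For $0\neq f\in k\langle X\rangle$ let $\bar f$ be its deg-lex leading word; $f$ is monic if $\bar f$ has coefficient $1$ in $f$. A Lyndon–Shirshov (LS) word is a word $w\neq1$ with $w>vu$ whenever $w=uv$, $u,v\ne1$. For an LS word $w$, the Lie monomial $[w]$ is defined by $[x]=x$ for $x\in X$, and $[w]=[[u],[v]]$ if $|w|\ge 2$ and $w=uv$ with $v$ the longest proper LS ending of $w$. If $w=aub$ and $u$ are LS words, let $[uc]$ be the smallest bracketed subword of $[w]$ containing this occurrence of $u$ (it begins with $u$), and let $c=c_1\cdots c_n$ with LS words $c_1\preceq\cdots\preceq c_n$; the special bracketing $[w]_u$ is obtained from $[w]$ by replacing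 $[uc]$ by $[\cdots[[u],[c_1]],\cdots,[c_n]]$. For monic $s\in\mathrm{Lie}(X)$ such that $a\bar sb$ is an LS word, $[asb]_{\bar s}$ is obtained from $[a\bar sb]_{\bar s}$ by replacing $[\bar s]$ by $s$. A normal $s$-word is any Lie bracketing $(asb)$ of the word $asb$ (with $a,b\in X^*$ and $s$ treated as one letter) whose leading word is $a\bar sb$. Let $S\subset \mathrm{Lie}(X)$ be a set of monic Lie polynomials. * For $f,g\in S$, the associative compositions are $fb-ag$ with respect to $w$, whenever $w=\bar fb=a\bar g$ with $|w|<|\bar f|+|\bar g|$ (intersection), and $f-agb$ with respect to $w$, whenever $w=\bar f=a\bar gb$ (inclusion). $S$ is a Gröbner–Shirshov basis in $k\langle X\rangle$ if every such composition is a $k$-linear combination of elements $a's b'$ with $s\in S$, $a',b'\in X^*$ and $a'\bar sb'<w$. * The Lie compositions, for the same $w,a,b$, are $[fb]_{\bar f}-[ag]_{\bar g}$ (intersection) and $f-[agb]_{\bar g}$ (inclusion). $S$ is a Gröbner–Shirshov basis in $\mathrm{Lie}(X)$ if every such composition is a $k$-linear combination of normal words $(a'sb')$ with $s\in S$ and $a'\bar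 sb'<w$. A word is $S$-irreducible if it is not of the form $a\bar sb$ with $s\in S$. Let $L=\mathrm{Lie}(X\mid S)$ be the quotient of $\mathrm{Lie}(X)$ by the Lie ideal generated by $S$, and let $U(L)=k\langle X\mid S\rangle$ be the quotient of $k\langle X\rangle$ by the two-sided ideal generated by $S$. **Theorem (PBW theorem in Shirshov's form).** $S$ is a Gröbner–Shirshov basis in $\mathrm{Lie}(X)$ if and only if $S$ is a Gröbner–Shirshov basis in $k\langle X\rangle$. Moreover, the following are equivalent: 1. $S$ is a Gröbner–Shirshov basis in $\mathrm{Lie}(X)$; 2. $S$ is a Gröbner–Shirshov basis in $k\langle X\rangle$; 3. the words $u_1\cdots u_n$, where $n\ge0$ and $u_1\preceq\cdots\preceq u_n$ are $S$-irreducible LS words, form a linear basis of $U(L)$; 4. the Lie monomials $[u]$, where $u$ is an $S$-irreducible LS word, form a linear basis of $L$; 5. the polynomials $[u_1]\cdots[u_n]$, where $n\ge0$ and $u_1\preceq\cdots\preceq u_n$ are $S$-irreducible LS words, form a linear basis of $U(L)$. (In 3–5, the families of residue classes, indexed by the sequences $(u_1,\dots,u_n)$, resp. by the words $u$, are linear bases.)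 -/

import Mathlib

universe u v

attribute [local instance] LieRing.ofAssociativeRing

namespace GSLie

/-! ### Words over a linearly ordered alphabet

A word is a list of letters, the empty word is `[]`, and the product of words is `++`. -/

section Words

variable {X : Type v} [LinearOrder X]

/-- `LexLT u v` is `u ≺ v` for the lexicographic order in which the empty word is the *largest*
word: `1 ≻ v` for `v ≠ 1`, and `x u₁ ≺ y v₁` iff `x < y`, or `x = y` and `u₁ ≺ v₁`. -/
def LexLT : List X → List X → Prop
  | [], _ => False
  | _ :: _, [] => True
  | x :: u, y :: v => x < y ∨ (x = y ∧ LexLT u v)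

/-- `u ⪯ v` in the lexicographic order. -/
def LexLE (u v : List X) : Prop := u = v ∨ LexLT u v

/-- `DegLexLT u v` is `u < v` in the deg-lex order: first compare lengths, then use `≺`. -/
def DegLexLT (u v : List X) : Prop :=
  u.length < v.length ∨ (u.length = v.length ∧ LexLT u v)

/-- Associative Lyndon–Shirshov words: nonempty words `w` with `w > v u` for every
factorization `w = u v` into nonempty words. -/
def IsALSW (w : List X) : Prop :=
  w ≠ [] ∧ ∀ u v : List X, u ≠ [] → v ≠ [] → w = u ++ v → DegLexLT (v ++ u) w

open Classical in
/-- The longest Lyndon–Shirshov ending of a word (`[]` for the empty word). -/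
noncomputable def longestLSEnding : List X → List X
  | [] => []
  | x :: l => if IsALSW (x :: l) then x :: l else longestLSEnding l

theorem longestLSEnding_length_le (l : List X) : (longestLSEnding l).length ≤ l.length := by
  induction l with
  | nil => simp [longestLSEnding]
  | cons x l ih =>
    unfold longestLSEnding
    split
    · exact le_rfl
    · simp only [List.length_cons]; omega

theorem isALSW_singleton (x : X) : IsALSW [x] := by
  refine ⟨by simp, fun u v hu hv h => ?_⟩
  have h1 := congrArg List.length h
  have h2 := List.length_pos_of_ne_nil hu
  have h3 := List.length_pos_of_ne_nil hv
  simp only [List.length_append, List.length_singleton] at h1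
  omega

theorem longestLSEnding_length_pos (l : List X) (h : l ≠ []) :
    0 < (longestLSEnding l).length := by
  induction l with
  | nil => exact absurd rfl h
  | cons x l ih =>
    unfold longestLSEnding
    split
    · simp
    · rename_i hx
      apply ih
      rintro rfl
      exact hx (isALSW_singleton x)

/-- The right factor of `w`: its longest *proper* Lyndon–Shirshov ending. -/
noncomputable def stdRight (w : List X) : List X := longestLSEnding w.tail

/-- The left factor of `w`, so that `w = stdLeft w ++ stdRight w`. -/
noncomputable def stdLeft (w : List X) : List X :=
  w.take (w.length - (stdRight w).length)

theorem stdRight_length_lt (w : List X) (h : 2 ≤ w.length) :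
    (stdRight w).length < w.length := by
  have := longestLSEnding_length_le w.tail
  simp only [stdRight, List.length_tail] at *
  omega

theorem stdLeft_length_lt (w : List X) (h : 2 ≤ w.length) :
    (stdLeft w).length < w.length := by
  have h0 : w.tail ≠ [] := by
    intro h1
    have := congrArg List.length h1
    simp only [List.length_tail, List.length_nil] at this
    omega
  have := longestLSEnding_length_pos w.tail h0
  simp only [stdLeft, stdRight, List.length_take] at *
  omega

/-- `c` is a Shirshov factorization: a list of Lyndon–Shirshov words `c₁ ⪯ c₂ ⪯ ⋯ ⪯ cₙ`
in the lexicographic order (`n = 0` is allowed). -/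
def IsShirshovList (c : List (List X)) : Prop :=
  (∀ u ∈ c, IsALSW u) ∧ c.Pairwise LexLE

open Classical in
/-- The Shirshov factorization `b = c₁ c₂ ⋯ cₙ` of a word `b`, that is, its (unique)
representation as a product of a list of Lyndon–Shirshov words with `c₁ ⪯ c₂ ⪯ ⋯ ⪯ cₙ`. -/
noncomputable def shirshovFactors (b : List X) : List (List X) :=
  if h : ∃ c : List (List X), IsShirshovList c ∧ c.flatten = b then h.choose else []

end Words

/-! ### Polynomials -/

/-- The free associative algebra `k⟨X⟩`, with linear basis the free monoid on `X`. -/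
abbrev NCPoly (k : Type u) [Field k] (X : Type v) := MonoidAlgebra k (FreeMonoid X)

section Poly

variable (k : Type u) [Field k] {X : Type v}

/-- A word as an element of `k⟨X⟩`. -/
noncomputable def mono (w : List X) : NCPoly k X :=
  MonoidAlgebra.single (FreeMonoid.ofList w) 1

/-- The free Lie algebra `Lie(X)`, i.e. the Lie subalgebra of `k⟨X⟩` (with the commutator
bracket) generated by the letters. -/
noncomputable def freeLie (X : Type v) : LieSubalgebra k (NCPoly k X) :=
  LieSubalgebra.lieSpan k (NCPoly k X) (Set.range fun x : X => mono k [x])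

variable {k}

/-- The coefficient of the word `w` in `f`. -/
noncomputable def wcoeff (f : NCPoly k X) (w : List X) : k :=
  f.coeff (FreeMonoid.ofList w)

variable [LinearOrder X]

/-- `w` is the deg-lex largest word occurring in `f`. -/
def IsLeadingWord (f : NCPoly k X) (w : List X) : Prop :=
  wcoeff f w ≠ 0 ∧ ∀ v : List X, wcoeff f v ≠ 0 → v = w ∨ DegLexLT v w

open Classical in
/-- The leading word of a nonzero polynomial (and `[]` for `f = 0`). -/
noncomputable def lead (f : NCPoly k X) : List X :=
  if h : ∃ w, IsLeadingWord f w then h.choose else []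

/-- A polynomial is monic if the coefficient of its leading word is `1`
(in particular it is nonzero). -/
def IsMonic (f : NCPoly k X) : Prop := wcoeff f (lead f) = 1

variable (k) in
/-- The Lie monomial `[w] ∈ Lie(X)` for a Lyndon–Shirshov word `w`, given by
`[w] = [[u], [v]]`, where `w = u v` and `v` is the longest proper Lyndon–Shirshov ending. -/
noncomputable def lsBracket : List X → NCPoly k X
  | [] => 0
  | [x] => mono k [x]
  | x :: y :: l =>
    ⁅lsBracket (stdLeft (x :: y :: l)), lsBracket (stdRight (x :: y :: l))⁆
termination_by w => w.length
decreasing_by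
  · exact stdLeft_length_lt _ (by simp)
  · exact stdRight_length_lt _ (by simp)

theorem lsBracket_mem (w : List X) : lsBracket k w ∈ freeLie k X := by
  induction hn : w.length using Nat.strong_induction_on generalizing w with
  | _ n ih =>
    subst hn
    match w with
    | [] => rw [lsBracket]; exact zero_mem _
    | [x] => rw [lsBracket]; exact LieSubalgebra.subset_lieSpan ⟨x, rfl⟩
    | x :: y :: l =>
      rw [lsBracket]
      exact (freeLie k X).lie_mem
        (ih _ (stdLeft_length_lt _ (by simp)) _ rfl) (ih _ (stdRight_length_lt _ (by simp)) _ rfl)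

/-- Shirshov's special bracketing `[a u b]_u` of the Lyndon–Shirshov word `w = a u b` relative to
its Lyndon–Shirshov subword `u`, with `[u]` replaced by the polynomial `p`.

One descends in the bracketing of `w` along the standard factorizations `w = w₁ w₂` as long as the
marked occurrence of `u` lies inside `w₁` or inside `w₂`. The smallest bracketed subword `[u c]`
reached in this way (`c` the part of the subword after `u`, possibly empty) is replaced by
`[⋯[[p, [c₁]], [c₂]], ⋯, [cₙ]]`, where `c = c₁ ⋯ cₙ` is the Shirshov factorization of `c`.
(If `w` and `u` are Lyndon–Shirshov words, then the smallest subword does start with `u`, so that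
`a = 1` in the last branch.) -/
noncomputable def specialBracket (a u b : List X) (p : NCPoly k X) : NCPoly k X :=
  if a = [] ∧ b = [] then p
  else if (a ++ u ++ b).length < 2 then 0
  else if a.length + u.length ≤ (stdLeft (a ++ u ++ b)).length then
    ⁅specialBracket a u (b.take ((stdLeft (a ++ u ++ b)).length - (a.length + u.length))) p,
      lsBracket k (stdRight (a ++ u ++ b))⁆
  else if (stdLeft (a ++ u ++ b)).length ≤ a.length then
    ⁅lsBracket k (stdLeft (a ++ u ++ b)),
      specialBracket (a.drop (stdLeft (a ++ u ++ b)).length) u b p⁆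
  else
    (shirshovFactors b).foldl (fun q c => ⁅q, lsBracket k c⁆) p
termination_by a.length + b.length
decreasing_by
  · rename_i _ h2 h3
    have h4 := stdLeft_length_lt (a ++ u ++ b) (by omega)
    generalize (stdLeft (a ++ u ++ b)).length = m at *
    simp only [List.length_append, List.length_take] at *
    omega
  · rename_i _ h2 _ h4
    have h5 := stdRight_length_lt (a ++ u ++ b) (by omega)
    have h6 : 0 < (stdLeft (a ++ u ++ b)).length := by
      simp only [stdLeft, List.length_take]
      omega
    simp only [List.length_drop]
    omega

/-- The special normal word `[a s b]_{s̄}`. -/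
noncomputable def specialNormal (a : List X) (s : NCPoly k X) (b : List X) : NCPoly k X :=
  specialBracket a (lead s) b s

/-! ### Gröbner–Shirshov bases in `k⟨X⟩` -/

/-- `h ≡ 0 mod (S, w)` in `k⟨X⟩`: `h` is a linear combination of polynomials `a s b` with
`s ∈ S` and `a s̄ b < w`. -/
def AssocTrivial (S : Set (NCPoly k X)) (w : List X) (h : NCPoly k X) : Prop :=
  h ∈ Submodule.span k {p : NCPoly k X | ∃ s ∈ S, ∃ a b : List X,
    DegLexLT (a ++ lead s ++ b) w ∧ p = mono k a * s * mono k b}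

/-- `S` is a Gröbner–Shirshov basis in `k⟨X⟩` (deg-lex order): all intersection and inclusion
compositions are trivial. -/
def IsAssocGSBasis (S : Set (NCPoly k X)) : Prop :=
  ∀ f ∈ S, ∀ g ∈ S,
    (∀ w a b : List X, w = lead f ++ b → w = a ++ lead g →
      w.length < (lead f).length + (lead g).length →
      AssocTrivial S w (f * mono k b - mono k a * g)) ∧
    (∀ w a b : List X, w = lead f → w = a ++ lead g ++ b →
      AssocTrivial S w (f - mono k a * g * mono k b))

/-! ### Gröbner–Shirshov bases in `Lie(X)` -/

/-- A nonassociative (Lie) monomial in the letters, as an element of `k⟨X⟩`, together with its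
underlying word. -/
inductive LieMonomial : List X → NCPoly k X → Prop
  | letter (x : X) : LieMonomial [x] (mono k [x])
  | bracket {u v : List X} {p q : NCPoly k X} :
      LieMonomial u p → LieMonomial v q → LieMonomial (u ++ v) ⁅p, q⁆

/-- `LieSWord s a b p`: the polynomial `p` is a Lie word `(a s b)`, i.e. an arbitrary Lie
bracketing of the word `a s b`, in which `s` occurs once as a letter. -/
inductive LieSWord (s : NCPoly k X) : List X → List X → NCPoly k X → Prop
  | base : LieSWord s [] [] s
  | left {t a b : List X} {q p : NCPoly k X} :
      LieMonomial t q → LieSWord s a b p → LieSWord s (t ++ a) b ⁅q, p⁆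
  | right {t a b : List X} {q p : NCPoly k X} :
      LieSWord s a b p → LieMonomial t q → LieSWord s a (b ++ t) ⁅p, q⁆

/-- `p` is a normal word `(a s b)`: a Lie word whose leading word is `a s̄ b`. -/
def IsNormalSWord (s : NCPoly k X) (a b : List X) (p : NCPoly k X) : Prop :=
  LieSWord s a b p ∧ IsLeadingWord p (a ++ lead s ++ b)

/-- `h ≡ 0 mod (S, w)` in `Lie(X)`: `h` is a linear combination of normal words `(a s b)` with
`s ∈ S` and `a s̄ b < w`. -/
def LieTrivial (S : Set (NCPoly k X)) (w : List X) (h : NCPoly k X) : Prop :=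
  h ∈ Submodule.span k {p : NCPoly k X | ∃ s ∈ S, ∃ a b : List X,
    DegLexLT (a ++ lead s ++ b) w ∧ IsNormalSWord s a b p}

/-- `S` is a Gröbner–Shirshov basis in `Lie(X)` (deg-lex order): all Lie intersection and
inclusion compositions are trivial. -/
def IsLieGSBasis (S : Set (NCPoly k X)) : Prop :=
  ∀ f ∈ S, ∀ g ∈ S,
    (∀ w a b : List X, w = lead f ++ b → w = a ++ lead g →
      w.length < (lead f).length + (lead g).length →
      LieTrivial S w (specialNormal [] f b - specialNormal a g [])) ∧
    (∀ w a b : List X, w = lead f → w = a ++ lead g ++ b →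
      LieTrivial S w (f - specialNormal a g b))

/-! ### Quotients, irreducible words, linear bases -/

/-- A word is `S`-irreducible if it has no subword `s̄` with `s ∈ S`. -/
def IsIrr (S : Set (NCPoly k X)) (w : List X) : Prop :=
  ∀ s ∈ S, ∀ a b : List X, w ≠ a ++ lead s ++ b


/-- The enveloping algebra `U(L) = k⟨X | S⟩` of `L = Lie(X | S)`: the quotient of `k⟨X⟩` by the
two-sided ideal generated by `S`. -/
abbrev Env (S : Set (NCPoly k X)) := (TwoSidedIdeal.span S).ringCon.Quotient

/-- The class of a polynomial in `k⟨X | S⟩`. -/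
noncomputable def toEnv (S : Set (NCPoly k X)) (f : NCPoly k X) : Env S :=
  (TwoSidedIdeal.span S).ringCon.mk' f

/-- The Lie ideal of `Lie(X)` generated by `S`. -/
noncomputable def lieIdeal (S : Set (NCPoly k X)) : LieIdeal k (freeLie k X) :=
  LieSubmodule.lieSpan k (freeLie k X) {p : freeLie k X | (p : NCPoly k X) ∈ S}

/-- The Lie algebra `Lie(X | S)`. -/
abbrev LieQuot (S : Set (NCPoly k X)) := freeLie k X ⧸ lieIdeal S

/-- The class of `[w]` in `Lie(X | S)`. -/
noncomputable def lieClass (S : Set (NCPoly k X)) (w : List X) : LieQuot S :=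
  LieSubmodule.Quotient.mk (N := lieIdeal S) ⟨lsBracket k w, lsBracket_mem w⟩

/-- The sequences `u₁ ⪯ ⋯ ⪯ uₙ`, `n ≥ 0`, of `S`-irreducible Lyndon–Shirshov words. -/
abbrev IrrSeq (S : Set (NCPoly k X)) : Type v :=
  {c : List (List X) // IsShirshovList c ∧ ∀ u ∈ c, IsIrr S u}

/-- The `S`-irreducible Lyndon–Shirshov words. -/
abbrev IrrLS (S : Set (NCPoly k X)) : Type v := {u : List X // IsALSW u ∧ IsIrr S u}

end Poly

/-- The family `e` is a linear basis of the vector space `M`. -/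
def IsLinearBasis (k : Type u) [Field k] {ι : Type*} {M : Type*} [AddCommGroup M] [Module k M]
    (e : ι → M) : Prop :=
  LinearIndependent k e ∧ Submodule.span k (Set.range e) = ⊤

end GSLie

/-!
Everything takes place in `k⟨X⟩`; the theorem follows from Gaussian elimination along the deg-lex
order together with three facts about leading words.

*The composition–diamond lemma in `k⟨X⟩`* (`IsAssocGSBasis.lead_mem`): if `S` is a
Gröbner–Shirshov basis in `k⟨X⟩`, the leading words of the elements of the ideal `(S)` are not
`S`-irreducible. Consequently an element of `(S)` whose words are all smaller than `w` is trivial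
modulo `w` (`IsAssocGSBasis.assocTrivial`).

*Lie polynomials have Lyndon–Shirshov leading words* (`isALSW_of_isLeadingWord`): the `[w]` are
monic with leading word `w`, and they span `Lie(X)`, because a bracket `[[u], [v]]` can be rewritten
in terms of them (`lie_lsBracket_mem`).

*Special normal words are normal* (`specialBracket_spec`): `[a s b]_{s̄}` is a Lie bracketing of
`a s b` which is monic with leading word `a s̄ b`.

Elimination (`mem_span_of_isLeadingWord`) writes every polynomial as a combination of arbitrarily
chosen monic polynomials `e w` with `S`-irreducible leading words `w`, and of multiples `a s b`. By
the composition–diamond lemma, the classes of the `e w` are a basis of the quotient when `S` is a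
Gröbner–Shirshov basis; conversely, if they are linearly independent, then applying elimination to a
composition leaves only multiples `a s b` with small leading words. For `e w = w` and for
`e w = [u₁]⋯[uₙ]`, where `w = u₁ ⋯ uₙ` is the Shirshov factorization, this shows that being a
Gröbner–Shirshov basis in `k⟨X⟩` is equivalent to each of the two basis conditions on the enveloping
algebra; the irreducible words are the products of irreducible Lyndon–Shirshov words since the
words `s̄` are Lyndon–Shirshov words. The same elimination inside `Lie(X)`, with the `[w]` and the
special normal words, shows that a Gröbner–Shirshov basis in `k⟨X⟩` yields a linear basis of
`Lie(X | S)`, and that such a linear basis makes `S` a Gröbner–Shirshov basis in `Lie(X)`.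

To return from `Lie(X)` to `k⟨X⟩`, the key point is that a Lyndon–Shirshov word has no proper
overlap with itself, so that `{s}` alone is a Gröbner–Shirshov basis in `k⟨X⟩`
(`isAssocGSBasis_singleton`). Hence every normal `s`-word, and every difference
`a s b - [a s b]_{s̄}`, is a combination of multiples of `s` with leading words bounded by its own
leading word, and a Lie composition being trivial makes the associative composition trivial.
-/

namespace GSLie

/-! ### The lexicographic and the deg-lex order -/

section Order

variable {X : Type v} [LinearOrder X]

theorem LexLT.irrefl (u : List X) : ¬ LexLT u u := by
  induction u with
  | nil => simp [LexLT]
  | cons x u ih => simp [LexLT, ih]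

theorem LexLT.trans {u v w : List X} (h₁ : LexLT u v) (h₂ : LexLT v w) : LexLT u w := by
  induction u generalizing v w with
  | nil => simp [LexLT] at h₁
  | cons x u ih =>
    match v, w with
    | [], _ => simp [LexLT] at h₂
    | _ :: _, [] => simp [LexLT]
    | y :: v, z :: w =>
      simp only [LexLT] at *
      rcases h₁ with h₁ | ⟨rfl, h₁⟩ <;> rcases h₂ with h₂ | ⟨rfl, h₂⟩
      · exact .inl (h₁.trans h₂)
      · exact .inl h₁
      · exact .inl h₂
      · exact .inr ⟨rfl, ih h₁ h₂⟩

theorem lexLT_trichotomy (u v : List X) : LexLT u v ∨ u = v ∨ LexLT v u := by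
  induction u generalizing v with
  | nil => cases v <;> simp [LexLT]
  | cons x u ih =>
    match v with
    | [] => simp [LexLT]
    | y :: v =>
      simp only [LexLT]
      rcases lt_trichotomy x y with h | rfl | h
      · exact .inl (.inl h)
      · rcases ih v with h | rfl | h
        · exact .inl (.inr ⟨rfl, h⟩)
        · exact .inr (.inl rfl)
        · exact .inr (.inr (.inr ⟨rfl, h⟩))
      · exact .inr (.inr (.inl h))

theorem LexLE.refl (u : List X) : LexLE u u := .inl rfl

theorem LexLE.trans {u v w : List X} (h₁ : LexLE u v) (h₂ : LexLE v w) : LexLE u w := by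
  rcases h₁ with rfl | h₁
  · exact h₂
  · rcases h₂ with rfl | h₂
    · exact .inr h₁
    · exact .inr (h₁.trans h₂)

theorem LexLE.trans_lt {u v w : List X} (h₁ : LexLE u v) (h₂ : LexLT v w) : LexLT u w := by
  rcases h₁ with rfl | h₁
  · exact h₂
  · exact h₁.trans h₂

theorem LexLT.trans_le {u v w : List X} (h₁ : LexLT u v) (h₂ : LexLE v w) : LexLT u w := by
  rcases h₂ with rfl | h₂
  · exact h₁
  · exact h₁.trans h₂

theorem LexLT.not_le {u v : List X} (h : LexLT u v) : ¬ LexLE v u :=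
  fun h' => LexLT.irrefl _ (h.trans_le h')

theorem lexLE_or_lt (u v : List X) : LexLE u v ∨ LexLT v u := by
  rcases lexLT_trichotomy u v with h | h | h
  · exact .inl (.inr h)
  · exact .inl (.inl h)
  · exact .inr h

theorem lexLT_append_left_iff (a u v : List X) : LexLT (a ++ u) (a ++ v) ↔ LexLT u v := by
  induction a with
  | nil => rfl
  | cons x a ih => simp [LexLT, ih]

/-- A proper extension of a word is smaller than the word: the empty word is the largest one. -/
theorem lexLT_append_self (u : List X) {r : List X} (hr : r ≠ []) : LexLT (u ++ r) u := by
  obtain ⟨x, r, rfl⟩ := List.exists_cons_of_ne_nil hr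
  have := (lexLT_append_left_iff u (x :: r) []).2 (by simp [LexLT])
  simpa using this

theorem lexLE_append_self (u r : List X) : LexLE (u ++ r) u := by
  by_cases hr : r = []
  · exact .inl (by simp [hr])
  · exact .inr (lexLT_append_self u hr)

/-- If `u ≺ v` and `u` is not longer than `v`, then `u` and `v` differ at some position, so that
the comparison is not affected by what follows. -/
theorem LexLT.append {u v : List X} (h : LexLT u v) (hl : u.length ≤ v.length) (s t : List X) :
    LexLT (u ++ s) (v ++ t) := by
  induction u generalizing v with
  | nil => simp [LexLT] at h
  | cons x u ih =>
    match v with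
    | [] => simp at hl
    | y :: v =>
      simp only [LexLT, List.cons_append, List.length_cons] at *
      rcases h with h | ⟨rfl, h⟩
      · exact .inl h
      · exact .inr ⟨rfl, ih h (by omega)⟩

theorem DegLexLT.irrefl (u : List X) : ¬ DegLexLT u u := by
  simp [DegLexLT, LexLT.irrefl]

theorem DegLexLT.trans {u v w : List X} (h₁ : DegLexLT u v) (h₂ : DegLexLT v w) :
    DegLexLT u w := by
  rcases h₁ with h₁ | ⟨h₁, h₁'⟩ <;> rcases h₂ with h₂ | ⟨h₂, h₂'⟩
  · exact .inl (h₁.trans h₂)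
  · exact .inl (h₂ ▸ h₁)
  · exact .inl (h₁ ▸ h₂)
  · exact .inr ⟨h₁.trans h₂, h₁'.trans h₂'⟩

theorem degLexLT_trichotomy (u v : List X) : DegLexLT u v ∨ u = v ∨ DegLexLT v u := by
  rcases lt_trichotomy u.length v.length with h | h | h
  · exact .inl (.inl h)
  · rcases lexLT_trichotomy u v with h' | h' | h'
    · exact .inl (.inr ⟨h, h'⟩)
    · exact .inr (.inl h')
    · exact .inr (.inr (.inr ⟨h.symm, h'⟩))
  · exact .inr (.inr (.inl h))

theorem DegLexLT.append_left {u v : List X} (h : DegLexLT u v) (a : List X) :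
    DegLexLT (a ++ u) (a ++ v) := by
  rcases h with h | ⟨h, h'⟩
  · exact .inl (by simpa using h)
  · exact .inr ⟨by simpa using h, (lexLT_append_left_iff a u v).2 h'⟩

theorem DegLexLT.append_right {u v : List X} (h : DegLexLT u v) (b : List X) :
    DegLexLT (u ++ b) (v ++ b) := by
  rcases h with h | ⟨h, h'⟩
  · exact .inl (by simpa using h)
  · exact .inr ⟨by simpa using h, h'.append h.le b b⟩

/-- On words of equal length `≺` is the usual lexicographic order. -/
theorem LexLT.listLex {u v : List X} (h : LexLT u v) (hl : u.length = v.length) :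
    List.Lex (· < ·) u v := by
  induction u generalizing v with
  | nil => simp [LexLT] at h
  | cons x u ih =>
    match v with
    | [] => simp at hl
    | y :: v =>
      simp only [LexLT, List.length_cons] at *
      rcases h with h | ⟨rfl, h⟩
      · exact .rel h
      · exact .cons (ih h (by omega))

theorem degLexLT_wellFounded [WellFoundedLT X] : WellFounded (DegLexLT (X := X)) := by
  refine Subrelation.wf (r := List.Shortlex (· < ·)) ?_ (List.Shortlex.wf wellFounded_lt)
  rintro u v (h | ⟨h, h'⟩)
  · exact List.Shortlex.of_length_lt h
  · exact List.Shortlex.of_lex h (h'.listLex h)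

end Order

/-! ### Lyndon–Shirshov words -/

section LSWords

variable {X : Type v} [LinearOrder X]

theorem IsALSW.ne_nil {w : List X} (h : IsALSW w) : w ≠ [] := h.1

theorem IsALSW.length_pos {w : List X} (h : IsALSW w) : 0 < w.length :=
  List.length_pos_of_ne_nil h.1

theorem IsALSW.rotate_lt {u v : List X} (h : IsALSW (u ++ v)) (hu : u ≠ []) (hv : v ≠ []) :
    LexLT (v ++ u) (u ++ v) := by
  rcases h.2 u v hu hv rfl with h | h
  · simp [Nat.add_comm] at h
  · exact h.2

/-- A Lyndon–Shirshov word is larger than its proper nonempty endings. -/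
theorem IsALSW.suffix_lt {u v : List X} (h : IsALSW (u ++ v)) (hu : u ≠ []) (hv : v ≠ []) :
    LexLT v (u ++ v) := by
  rcases lexLT_trichotomy v (u ++ v) with h' | h' | h'
  · exact h'
  · exact absurd (List.self_eq_append_left.1 h') hu
  exfalso
  by_cases hp : v <+: u ++ v
  · -- a word `uv = vt` with border `v` has the rotations `vu` and `tv`,
    -- which cannot both be smaller
    obtain ⟨t, ht⟩ := hp
    have hl : t.length = u.length := by
      have := congrArg List.length ht
      simp only [List.length_append] at this
      omega
    have ht0 : t ≠ [] := by
      rintro rfl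
      exact hu (List.length_eq_zero_iff.1 hl.symm)
    have h1 := h.rotate_lt hu hv
    rw [← ht, lexLT_append_left_iff] at h1
    have h2 := (ht ▸ h : IsALSW (v ++ t)).rotate_lt hv ht0
    rw [ht] at h2
    exact LexLT.irrefl _ (h2.trans (h1.append hl.ge v v))
  · have h1 : LexLT (u ++ v) (v ++ u) := by
      have hlt : LexLT ((u ++ v).take v.length) v := by
        have h3 : (u ++ v).take v.length ++ (u ++ v).drop v.length = u ++ v :=
          List.take_append_drop _ _
        rcases lexLT_trichotomy ((u ++ v).take v.length) v with h4 | h4 | h4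
        · exact h4
        · exact absurd ⟨_, by rwa [h4] at h3⟩ hp
        · exfalso
          have := h4.append (by simp) [] ((u ++ v).drop v.length)
          rw [h3, List.append_nil] at this
          exact LexLT.irrefl _ (this.trans h')
      have := hlt.append (by simp) ((u ++ v).drop v.length) u
      rwa [List.take_append_drop] at this
    exact LexLT.irrefl _ (h1.trans (h.rotate_lt hu hv))

theorem isALSW_of_suffix_lt {w : List X} (hw : w ≠ [])
    (h : ∀ u v : List X, u ≠ [] → v ≠ [] → w = u ++ v → LexLT v w) : IsALSW w := by
  refine ⟨hw, fun u v hu hv e => .inr ⟨by simp [e, Nat.add_comm], ?_⟩⟩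
  simpa using (h u v hu hv e).append (by simp [e]) u []

/-- If `u ≻ v` are Lyndon–Shirshov words, then so is `uv`. -/
theorem IsALSW.append {u v : List X} (hu : IsALSW u) (hv : IsALSW v) (h : LexLT v u) :
    IsALSW (u ++ v) := by
  have hvw : LexLT v (u ++ v) := by
    by_cases hp : u <+: v
    · obtain ⟨r, rfl⟩ := hp
      have hr : r ≠ [] := by
        rintro rfl
        rw [List.append_nil] at h
        exact LexLT.irrefl _ h
      exact (lexLT_append_left_iff _ _ _).2 (hv.suffix_lt hu.ne_nil hr)
    · have h1 : LexLT (v.take u.length) u := by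
        rcases lexLT_trichotomy (v.take u.length) u with h4 | h4 | h4
        · exact h4
        · exact absurd (h4 ▸ List.take_prefix _ _ : u <+: v) hp
        · exfalso
          by_cases hl : u.length ≤ v.length
          · have := h4.append (by simp [hl]) [] (v.drop u.length)
            rw [List.take_append_drop, List.append_nil] at this
            exact LexLT.irrefl _ (this.trans h)
          · rw [List.take_of_length_le (by omega)] at h4
            exact LexLT.irrefl _ (h4.trans h)
      have := h1.append (by simp) (v.drop u.length) v
      rwa [List.take_append_drop] at this
  refine isALSW_of_suffix_lt (by simp [hu.ne_nil]) fun a b ha hb e => ?_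
  rcases List.append_eq_append_iff.1 e with ⟨a', rfl, e2⟩ | ⟨a', rfl, rfl⟩
  · by_cases ha' : a' = []
    · subst ha'
      rw [List.nil_append] at e2
      exact e2 ▸ hvw
    · subst e2
      exact (hv.suffix_lt ha' hb).trans hvw
  · by_cases ha' : a' = []
    · subst ha'
      simpa using hvw
    · exact (hu.suffix_lt ha ha').append (by simp) v v

/-- If `xy` and `yz` are Lyndon–Shirshov words that overlap in a nonempty word `y`, then `xyz` is a
Lyndon–Shirshov word. -/
theorem IsALSW.overlap {x y z : List X} (h₁ : IsALSW (x ++ y)) (h₂ : IsALSW (y ++ z))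
    (hy : y ≠ []) : IsALSW (x ++ y ++ z) := by
  by_cases hx : x = []
  · simpa [hx] using h₂
  have hyz : LexLT (y ++ z) (x ++ y ++ z) := (h₁.suffix_lt hx hy).append (by simp) z z
  refine isALSW_of_suffix_lt (by simp [hx]) fun a b ha hb e => ?_
  rw [List.append_assoc] at e
  rcases List.append_eq_append_iff.1 e with ⟨a', rfl, e2⟩ | ⟨a', rfl, rfl⟩
  · by_cases ha' : a' = []
    · subst ha'
      rw [List.nil_append] at e2
      exact e2 ▸ hyz
    · rw [e2] at h₂ hyz
      exact (h₂.suffix_lt ha' hb).trans hyz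
  · by_cases ha' : a' = []
    · subst ha'
      simpa using hyz
    · rw [List.append_assoc] at h₁
      have := (h₁.suffix_lt ha (by simp [hy])).append (by simp) z z
      simpa using this

/-- A Lyndon–Shirshov word has no proper nonempty border. -/
theorem IsALSW.not_border {a b t : List X} (h : IsALSW (a ++ t)) (ha : a ≠ []) (ht : t ≠ [])
    (e : a ++ t = t ++ b) : False := by
  have h1 := h.suffix_lt ha ht
  rw [e] at h1
  exact h1.not_le (lexLE_append_self t b)

end LSWords

/-! ### The Shirshov factorization -/

section Shirshov

variable {X : Type v} [LinearOrder X]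

theorem isShirshovList_nil : IsShirshovList ([] : List (List X)) := by
  simp [IsShirshovList]

theorem isShirshovList_cons {u : List X} {c : List (List X)} :
    IsShirshovList (u :: c) ↔ IsALSW u ∧ (∀ v ∈ c, LexLE u v) ∧ IsShirshovList c := by
  simp only [IsShirshovList, List.mem_cons, forall_eq_or_imp, List.pairwise_cons]
  tauto

/-- Putting a Lyndon–Shirshov word in front of a Shirshov factorization: it absorbs the factors that
are smaller than it. -/
theorem exists_shirshovList_append {v : List X} (hv : IsALSW v) {c : List (List X)}
    (hc : IsShirshovList c) : ∃ d, IsShirshovList d ∧ d.flatten = v ++ c.flatten := by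
  induction c generalizing v with
  | nil => exact ⟨[v], by simp [isShirshovList_cons, isShirshovList_nil, hv], by simp⟩
  | cons u c ih =>
    have hc' := isShirshovList_cons.1 hc
    rcases lexLE_or_lt v u with h | h
    · refine ⟨v :: u :: c, isShirshovList_cons.2 ⟨hv, ?_, hc⟩, by simp⟩
      rintro w (_ | ⟨_, hw⟩)
      · exact h
      · exact h.trans (hc'.2.1 w hw)
    · obtain ⟨d, hd, e⟩ := ih (hv.append hc'.1 h) hc'.2.2
      exact ⟨d, hd, by simp [e]⟩

theorem exists_shirshovList (w : List X) : ∃ c, IsShirshovList c ∧ c.flatten = w := by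
  induction w with
  | nil => exact ⟨[], isShirshovList_nil, rfl⟩
  | cons x w ih =>
    obtain ⟨c, hc, rfl⟩ := ih
    exact exists_shirshovList_append (isALSW_singleton x) hc

theorem shirshovFactors_spec (b : List X) :
    IsShirshovList (shirshovFactors b) ∧ (shirshovFactors b).flatten = b := by
  unfold shirshovFactors
  rw [dif_pos (exists_shirshovList b)]
  exact (exists_shirshovList b).choose_spec

/-- A nonempty beginning of a product of words `⪰ u` has a nonempty ending that is `⪰ u`. -/
theorem exists_suffix_ge {u : List X} {c : List (List X)} (hc : ∀ v ∈ c, LexLE u v)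
    {q r : List X} (hq : q ≠ []) (e : c.flatten = q ++ r) :
    ∃ q' p, q = q' ++ p ∧ p ≠ [] ∧ LexLE u p := by
  induction c generalizing q with
  | nil =>
    exact absurd (List.append_eq_nil_iff.1 e.symm).1 hq
  | cons v c ih =>
    rw [List.flatten_cons] at e
    rcases List.append_eq_append_iff.1 e with ⟨a, rfl, e2⟩ | ⟨a, rfl, -⟩
    · by_cases ha : a = []
      · subst ha
        refine ⟨[], v, by simp, by simpa using hq, hc v (by simp)⟩
      · obtain ⟨q', p, rfl, hp, hle⟩ := ih (fun w hw => hc w (by simp [hw])) ha e2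
        exact ⟨v ++ q', p, by simp, hp, hle⟩
    · exact ⟨[], q, rfl, hq, (hc _ (by simp)).trans (lexLE_append_self q a)⟩

/-- A Lyndon–Shirshov subword of `c₁ ⋯ cₙ`, where `c₁ ⪯ ⋯ ⪯ cₙ` are Lyndon–Shirshov words, lies
within one of the factors. -/
theorem IsShirshovList.exists_factor {c : List (List X)} (hc : IsShirshovList c) {a v b : List X}
    (hv : IsALSW v) (e : c.flatten = a ++ v ++ b) :
    ∃ c₁ c₂ a' b', c = c₁ ++ (a' ++ v ++ b') :: c₂ ∧ a = c₁.flatten ++ a' ∧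
      b = b' ++ c₂.flatten := by
  induction c generalizing a with
  | nil => simp [hv.ne_nil] at e
  | cons u c ih =>
    have hc' := isShirshovList_cons.1 hc
    rw [List.flatten_cons, List.append_assoc] at e
    rcases List.append_eq_append_iff.1 e with ⟨a', rfl, e2⟩ | ⟨s, rfl, e2⟩
    · obtain ⟨c₁, c₂, a'', b', rfl, rfl, rfl⟩ := ih hc'.2.2 (e2.trans (List.append_assoc ..).symm)
      exact ⟨u :: c₁, c₂, a'', b', by simp, by simp, rfl⟩
    · rcases List.append_eq_append_iff.1 e2 with ⟨b', rfl, rfl⟩ | ⟨q, rfl, e3⟩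
      · exact ⟨[], c, a, b', by simp, by simp, by simp⟩
      · by_cases hs : s = []
        · subst hs
          obtain ⟨c₁, c₂, a'', b', rfl, e4, rfl⟩ := ih (a := []) hc'.2.2 (by simpa using e3)
          exact ⟨(a ++ []) :: c₁, c₂, a'', b', by simp, by simpa using e4, rfl⟩
        by_cases hq : q = []
        · subst hq
          refine ⟨[], c, a, [], by simp, by simp, by simpa using e3.symm⟩
        -- `v = s q` with `s` an ending of the first factor `a s`, and `q` has an ending `p ⪰ a s`
        exfalso
        obtain ⟨q', p, rfl, hp, hle⟩ := exists_suffix_ge hc'.2.1 hq e3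
        have h1 : LexLE s (a ++ s) := by
          by_cases ha : a = []
          · subst ha
            exact LexLE.refl _
          · exact .inr (hc'.1.suffix_lt ha hs)
        have h2 : LexLT p (s ++ (q' ++ p)) := by
          rw [← List.append_assoc] at hv ⊢
          exact hv.suffix_lt (by simp [hs]) hp
        exact h2.not_le (((lexLE_append_self s _).trans h1).trans hle)

theorem IsShirshovList.head_prefix {u : List X} {c d : List (List X)} (hu : IsALSW u)
    (hd : IsShirshovList d) (e : (u :: c).flatten = d.flatten) :
    ∃ b' d', d = (u ++ b') :: d' := by
  obtain ⟨c₁, c₂, a', b', rfl, e1, -⟩ := hd.exists_factor (a := []) hu (by simpa using e.symm)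
  obtain ⟨h1, rfl⟩ := List.append_eq_nil_iff.1 e1.symm
  match c₁ with
  | [] => exact ⟨b', c₂, rfl⟩
  | w :: c₁ =>
    exfalso
    have := hd.1 w (by simp)
    simp [this.ne_nil] at h1

/-- The Shirshov factorization is unique. -/
theorem IsShirshovList.flatten_inj {c d : List (List X)} (hc : IsShirshovList c)
    (hd : IsShirshovList d) (e : c.flatten = d.flatten) : c = d := by
  induction c generalizing d with
  | nil =>
    match d with
    | [] => rfl
    | u :: d =>
      have := (isShirshovList_cons.1 hd).1
      simp [this.ne_nil] at e
  | cons u c ih =>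
    have hc' := isShirshovList_cons.1 hc
    obtain ⟨b, d, rfl⟩ := IsShirshovList.head_prefix hc'.1 hd e
    have hd' := isShirshovList_cons.1 hd
    obtain ⟨b', d', e'⟩ := IsShirshovList.head_prefix hd'.1 hc e.symm
    have h1 := congrArg List.length (List.cons.inj e').1
    simp only [List.length_append] at h1
    obtain rfl : b = [] := List.length_eq_zero_iff.1 (by omega)
    simp only [List.append_nil, List.flatten_cons, List.append_cancel_left_eq] at e hd' ⊢
    rw [ih hc'.2.2 hd'.2.2 e]

theorem IsALSW.shirshovList_eq {c : List (List X)} (hc : IsShirshovList c)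
    (h : IsALSW c.flatten) : c = [c.flatten] :=
  hc.flatten_inj (by simp [isShirshovList_cons, isShirshovList_nil, h]) (by simp)

end Shirshov

/-! ### The standard factorization -/

section Standard

variable {X : Type v} [LinearOrder X]

theorem longestLSEnding_spec {l : List X} (hl : l ≠ []) :
    longestLSEnding l <:+ l ∧ IsALSW (longestLSEnding l) ∧
      ∀ t, t <:+ l → IsALSW t → t.length ≤ (longestLSEnding l).length := by
  induction l with
  | nil => exact absurd rfl hl
  | cons x l ih =>
    unfold longestLSEnding
    split
    · rename_i h
      exact ⟨List.suffix_rfl, h, fun t ht _ => ht.length_le⟩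
    · rename_i h
      have hl' : l ≠ [] := by
        rintro rfl
        exact h (isALSW_singleton x)
      obtain ⟨h1, h2, h3⟩ := ih hl'
      refine ⟨h1.trans (List.suffix_cons x l), h2, fun t ht htw => ?_⟩
      rcases List.suffix_cons_iff.1 ht with rfl | ht
      · exact absurd htw h
      · exact h3 t ht htw

theorem stdRight_suffix (w : List X) : stdRight w <:+ w := by
  by_cases h : w.tail = []
  · simp [stdRight, h, longestLSEnding]
  · exact (longestLSEnding_spec h).1.trans (List.tail_suffix w)

theorem stdLeft_append_stdRight (w : List X) : stdLeft w ++ stdRight w = w := by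
  obtain ⟨p, hp⟩ := stdRight_suffix w
  have : w.length - (stdRight w).length = p.length := by
    have := congrArg List.length hp
    simp only [List.length_append] at this
    omega
  unfold stdLeft
  rw [this]
  conv_rhs => rw [← hp]
  congr 1
  conv_lhs => rw [← hp]
  simp

omit [LinearOrder X] in
theorem tail_ne_nil {w : List X} (h : 2 ≤ w.length) : w.tail ≠ [] := by
  intro h'
  have := congrArg List.length h'
  simp only [List.length_tail, List.length_nil] at this
  omega

/-- A Shirshov factorization may be extended on the right by a word `⪰` its last factor. -/
theorem IsShirshovList.concat {d : List (List X)} {y v : List X} (hc : IsShirshovList (d ++ [y]))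
    (hv : IsALSW v) (hyv : LexLE y v) : IsShirshovList (d ++ [y] ++ [v]) := by
  refine ⟨?_, List.pairwise_append.2 ⟨hc.2, by simp, ?_⟩⟩
  · intro x hx
    rcases List.mem_append.1 hx with hx | hx
    · exact hc.1 x hx
    · rwa [List.mem_singleton.1 hx]
  · intro x hx z hz
    obtain rfl := List.mem_singleton.1 hz
    rcases List.mem_append.1 hx with hx | hx
    · exact ((List.pairwise_append.1 hc.2).2.2 x hx y (by simp)).trans hyv
    · rwa [List.mem_singleton.1 hx]

theorem isALSW_stdRight {w : List X} (h : 2 ≤ w.length) : IsALSW (stdRight w) :=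
  (longestLSEnding_spec (tail_ne_nil h)).2.1

theorem stdLeft_ne_nil {w : List X} (h : 2 ≤ w.length) : stdLeft w ≠ [] := by
  intro h'
  have h1 := stdLeft_append_stdRight w
  have h2 := stdRight_length_lt w h
  rw [h', List.nil_append] at h1
  rw [h1] at h2
  exact lt_irrefl _ h2

theorem length_le_stdRight {p t : List X} (hp : p ≠ []) (ht : IsALSW t) :
    t.length ≤ (stdRight (p ++ t)).length := by
  obtain ⟨x, p, rfl⟩ := List.exists_cons_of_ne_nil hp
  have h : (x :: p ++ t).tail ≠ [] := by simp [ht.ne_nil]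
  exact (longestLSEnding_spec h).2.2 t ⟨p, by simp⟩ ht

theorem isALSW_stdLeft {w : List X} (hw : IsALSW w) (h : 2 ≤ w.length) : IsALSW (stdLeft w) := by
  have hv := isALSW_stdRight h
  have hu := stdLeft_ne_nil h
  have e := stdLeft_append_stdRight w
  obtain ⟨hc, hce⟩ := shirshovFactors_spec (stdLeft w)
  generalize shirshovFactors (stdLeft w) = c at hc hce
  generalize stdLeft w = u at *
  generalize hvd : stdRight w = v at *
  subst hce
  rcases List.eq_nil_or_concat c with rfl | ⟨d, y, rfl⟩
  · simp at hu
  rw [List.concat_eq_append] at *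
  have hy : IsALSW y := hc.1 y (by simp)
  rcases lexLE_or_lt y v with hyv | hyv
  · -- otherwise appending `v` gives a Shirshov factorization of `w` with at least two factors
    have h1 := hc.concat hv hyv
    have h2 := IsALSW.shirshovList_eq h1 (by rw [← e] at hw; simpa using hw)
    have := congrArg List.length h2
    simp at this
  · -- `y v` is a Lyndon–Shirshov ending longer than `v`, hence it is all of `w`
    have h1 := hy.append hv hyv
    by_cases hd : d.flatten = []
    · simpa [hd] using hy
    · have h2 := length_le_stdRight hd h1
      have h3 : d.flatten ++ (y ++ v) = w := by simpa using e
      have := hy.length_pos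
      rw [h3, hvd, List.length_append] at h2
      omega

theorem stdRight_lt_stdLeft {w : List X} (hw : IsALSW w) (h : 2 ≤ w.length) :
    LexLT (stdRight w) (stdLeft w) := by
  have e := stdLeft_append_stdRight w
  rw [← e] at hw
  exact (hw.suffix_lt (stdLeft_ne_nil h) (isALSW_stdRight h).ne_nil).trans_le
    (lexLE_append_self _ _)

/-- For Lyndon–Shirshov words `u ≻ v`, the standard factorization of `uv` is `(u, v)` provided that
`u` is a letter or the right standard factor of `u` is `⪯ v`. -/
theorem stdRight_append {u v : List X} (hu : IsALSW u) (hv : IsALSW v)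
    (huv : 2 ≤ u.length → LexLE (stdRight u) v) : stdRight (u ++ v) = v := by
  have h2 : 2 ≤ (u ++ v).length := by
    have := hu.length_pos
    have := hv.length_pos
    simp only [List.length_append]
    omega
  have ht := isALSW_stdRight h2
  have hl := length_le_stdRight hu.ne_nil hv
  have hlt := stdLeft_ne_nil h2
  have e := stdLeft_append_stdRight (u ++ v)
  generalize stdRight (u ++ v) = t at *
  generalize stdLeft (u ++ v) = p at *
  obtain ⟨t', rfl, rfl⟩ : ∃ t', u = p ++ t' ∧ t = t' ++ v := by
    rcases List.append_eq_append_iff.1 e with ⟨t', h, h'⟩ | ⟨t', h, h'⟩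
    · exact ⟨t', h, h'⟩
    · have := congrArg List.length h'
      simp only [List.length_append] at this
      obtain rfl : t' = [] := List.length_eq_zero_iff.1 (by omega)
      exact ⟨[], by simpa using h.symm, by simpa using h'.symm⟩
  obtain ⟨hc, hce⟩ := shirshovFactors_spec t'
  generalize shirshovFactors t' = c at hc hce
  subst hce
  rcases List.eq_nil_or_concat c with rfl | ⟨d, y, rfl⟩
  · simp
  exfalso
  rw [List.concat_eq_append] at *
  have hy : IsALSW y := hc.1 y (by simp)
  have hyu : LexLE y v := by
    have hu2 : 2 ≤ (p ++ (d ++ [y]).flatten).length := by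
      have := List.length_pos_of_ne_nil hlt
      have := hy.length_pos
      simp only [List.length_append, List.flatten_append, List.flatten_singleton]
      omega
    refine LexLE.trans ?_ (huv hu2)
    have h3 := length_le_stdRight (p := p ++ d.flatten) (by simp [hlt]) hy
    have h4 := stdRight_suffix (p ++ (d ++ [y]).flatten)
    have h5 := isALSW_stdRight hu2
    have e2 : p ++ (d ++ [y]).flatten = p ++ d.flatten ++ y := by simp
    rw [e2] at h4 h5 ⊢
    generalize stdRight (p ++ d.flatten ++ y) = r at *
    obtain ⟨a, rfl⟩ : y <:+ r := List.suffix_of_suffix_length_le (List.suffix_append _ _) h4 h3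
    by_cases ha : a = []
    · exact .inl (by simp [ha])
    · exact .inr (h5.suffix_lt ha hy.ne_nil)
  have h1 := hc.concat hv hyu
  have h2 := IsALSW.shirshovList_eq h1 (by simpa using ht)
  have := congrArg List.length h2
  simp at this

theorem stdLeft_append {u v : List X} (h : stdRight (u ++ v) = v) : stdLeft (u ++ v) = u := by
  simp [stdLeft, h]

/-- A Lyndon–Shirshov subword of `w` that meets both standard factors of `w` is a beginning
of `w`. -/
theorem eq_nil_of_straddle {a u b : List X} (hu : IsALSW u) (h2 : 2 ≤ (a ++ u ++ b).length)
    (h3 : (stdLeft (a ++ u ++ b)).length < a.length + u.length)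
    (h4 : a.length < (stdLeft (a ++ u ++ b)).length) : a = [] := by
  by_contra ha
  have hr := isALSW_stdRight h2
  have e := stdLeft_append_stdRight (a ++ u ++ b)
  -- here `stdLeft = a x`, `u = x y` and `stdRight = y b`, so that `x y b` is a longer ending
  obtain ⟨x, hx⟩ : ∃ x, stdLeft (a ++ u ++ b) = a ++ x := by
    have h5 : a <+: stdLeft (a ++ u ++ b) := by
      refine List.prefix_of_prefix_length_le (l₃ := a ++ u ++ b) ⟨u ++ b, by simp⟩ ⟨_, e⟩ h4.le
    obtain ⟨x, hx⟩ := h5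
    exact ⟨x, hx.symm⟩
  rw [hx] at e h3 h4
  obtain ⟨y, rfl⟩ : ∃ y, u = x ++ y := by
    have e2 : x ++ stdRight (a ++ u ++ b) = u ++ b := by
      simpa only [List.append_assoc, List.append_cancel_left_eq] using e
    have h5 : x <+: u := by
      refine List.prefix_of_prefix_length_le ⟨_, e2⟩ ⟨b, rfl⟩ ?_
      simp only [List.length_append] at h3
      omega
    obtain ⟨y, hy⟩ := h5
    exact ⟨y, hy.symm⟩
  have hy : y ≠ [] := by
    rintro rfl
    simp at h3
  have e3 : stdRight (a ++ (x ++ y) ++ b) = y ++ b := by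
    simpa only [List.append_assoc, List.append_cancel_left_eq] using e
  rw [e3] at hr
  have h6 := length_le_stdRight ha (hu.overlap hr hy)
  have h7 : a ++ (x ++ y ++ b) = a ++ (x ++ y) ++ b := by simp
  rw [h7, e3] at h6
  simp only [List.length_append] at h6 h4
  omega

/-- One step of the bracketing `[⋯[[u],[c₁]],⋯,[cₙ]]`: if `u` and `u c₁ ⋯ cₙ` are Lyndon–Shirshov
words, then `u ≻ c₁` and `u c₁` is a Lyndon–Shirshov word, since `c₁ ⪯ cₙ ≺ u c₁ ⋯ cₙ ⪯ u`. -/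
theorem IsALSW.append_factor {u c : List X} {cs : List (List X)} (hu : IsALSW u)
    (hc : IsShirshovList (c :: cs)) (hw : IsALSW (u ++ (c :: cs).flatten)) :
    LexLT c u ∧ IsALSW (u ++ c) := by
  have hc0 := (isShirshovList_cons.1 hc).1
  have h : LexLT c u := by
    rcases List.eq_nil_or_concat cs with rfl | ⟨d, y, rfl⟩
    · rw [List.flatten_singleton] at hw
      exact (hw.suffix_lt hu.ne_nil hc0.ne_nil).trans_le (lexLE_append_self u _)
    · rw [List.concat_eq_append] at *
      have hy : IsALSW y := hc.1 y (by simp)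
      have h1 : LexLE c y := (isShirshovList_cons.1 hc).2.1 y (by simp)
      have e : u ++ (c :: (d ++ [y])).flatten = (u ++ c ++ d.flatten) ++ y := by simp
      have h2 : LexLE ((u ++ c ++ d.flatten) ++ y) u := by
        rw [List.append_assoc, List.append_assoc]
        exact lexLE_append_self u _
      rw [e] at hw
      exact h1.trans_lt ((hw.suffix_lt (by simp [hu.ne_nil]) hy.ne_nil).trans_le h2)
  exact ⟨h, hu.append hc0 h⟩

end Standard

/-! ### Leading words -/

section Leading

variable {k : Type u} [Field k] {X : Type v}

theorem mono_nil : mono k ([] : List X) = 1 := rfl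

theorem mono_append (a b : List X) : mono k (a ++ b) = mono k a * mono k b := by
  simp [mono, MonoidAlgebra.single_mul_single]

theorem wcoeff_mono [DecidableEq (List X)] (v w : List X) :
    wcoeff (mono k v) w = if v = w then 1 else 0 := by
  classical
  have : wcoeff (mono k v) w = if FreeMonoid.ofList v = FreeMonoid.ofList w then 1 else 0 := by
    unfold wcoeff mono
    rw [MonoidAlgebra.coeff_single, Finsupp.single_apply]
  rw [this]
  simp

theorem wcoeff_zero (w : List X) : wcoeff (0 : NCPoly k X) w = 0 := rfl

theorem wcoeff_sub (f g : NCPoly k X) (w : List X) :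
    wcoeff (f - g) w = wcoeff f w - wcoeff g w := by
  simp [wcoeff]

theorem wcoeff_smul (c : k) (f : NCPoly k X) (w : List X) :
    wcoeff (c • f) w = c * wcoeff f w := rfl

variable (k) in
/-- The polynomials all of whose words belong to `P`. -/
noncomputable def wordSpan (P : Set (List X)) : Submodule k (NCPoly k X) :=
  Submodule.span k (mono k '' P)

theorem mono_mem_wordSpan {P : Set (List X)} {w : List X} (h : w ∈ P) : mono k w ∈ wordSpan k P :=
  Submodule.subset_span ⟨w, h, rfl⟩

theorem mem_wordSpan {P : Set (List X)} {f : NCPoly k X} :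
    f ∈ wordSpan k P ↔ ∀ w, wcoeff f w ≠ 0 → w ∈ P := by
  have h : wordSpan k P = MonoidAlgebra.supported k k {m : FreeMonoid X | m.toList ∈ P} := by
    rw [MonoidAlgebra.supported_eq_span_single]
    rfl
  rw [h, MonoidAlgebra.mem_supported']
  constructor
  · intro h w hw
    by_contra hP
    exact hw (h (FreeMonoid.ofList w) hP)
  · intro h m hm
    by_contra hf
    exact hm (h m.toList hf)

theorem wordSpan_mono {P Q : Set (List X)} (h : P ⊆ Q) : wordSpan k P ≤ wordSpan k Q :=
  Submodule.span_mono (Set.image_mono h)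

theorem wordSpan_univ : wordSpan k (Set.univ : Set (List X)) = ⊤ :=
  eq_top_iff.2 fun _ _ => mem_wordSpan.2 fun _ _ => trivial

theorem mul_mem_wordSpan {P Q R : Set (List X)} (h : ∀ u ∈ P, ∀ v ∈ Q, u ++ v ∈ R)
    {f g : NCPoly k X} (hf : f ∈ wordSpan k P) (hg : g ∈ wordSpan k Q) :
    f * g ∈ wordSpan k R := by
  have h1 : wordSpan k P * wordSpan k Q ≤ wordSpan k R := by
    unfold wordSpan
    rw [Submodule.span_mul_span]
    refine Submodule.span_mono ?_
    rintro _ ⟨_, ⟨u, hu, rfl⟩, _, ⟨v, hv, rfl⟩, rfl⟩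
    exact ⟨u ++ v, h u hu v hv, mono_append u v⟩
  exact h1 (Submodule.mul_mem_mul hf hg)

variable [LinearOrder X]

variable (k) in
/-- The polynomials all of whose words are deg-lex smaller than `w`. -/
noncomputable abbrev lower (w : List X) : Submodule k (NCPoly k X) :=
  wordSpan k {v | DegLexLT v w}

theorem lower_mono {v w : List X} (h : DegLexLT v w) : lower k v ≤ lower k w :=
  wordSpan_mono fun _ hu => DegLexLT.trans hu h

/-- `f` is monic with leading word `w`, that is, `f = w + (smaller words)`. -/
def HasLead (f : NCPoly k X) (w : List X) : Prop := f - mono k w ∈ lower k w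

theorem hasLead_mono (w : List X) : HasLead (mono k w) w := by
  simp [HasLead]

theorem hasLead_iff {f : NCPoly k X} {w : List X} :
    HasLead f w ↔ wcoeff f w = 1 ∧ IsLeadingWord f w := by
  classical
  simp only [HasLead, mem_wordSpan, wcoeff_sub, wcoeff_mono, IsLeadingWord, Set.mem_ofPred_eq]
  constructor
  · intro h
    have h1 : wcoeff f w = 1 := by
      by_contra h1
      exact DegLexLT.irrefl _ (h w (by simpa [sub_eq_zero] using h1))
    refine ⟨h1, by simp [h1], fun v hv => ?_⟩
    by_cases hvw : v = w
    · exact .inl hvw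
    · exact .inr (h v (by simpa [Ne.symm hvw] using hv))
  · rintro ⟨h1, -, h2⟩ v hv
    by_cases hvw : w = v
    · subst hvw
      simp [h1] at hv
    · rcases h2 v (by simpa [hvw] using hv) with h | h
      · exact absurd h.symm hvw
      · exact h

theorem IsLeadingWord.unique {f : NCPoly k X} {v w : List X} (hv : IsLeadingWord f v)
    (hw : IsLeadingWord f w) : v = w := by
  rcases hw.2 v hv.1 with h | h
  · exact h
  · rcases hv.2 w hw.1 with h' | h'
    · exact h'.symm
    · exact absurd (h.trans h') (DegLexLT.irrefl _)

theorem exists_isLeadingWord {f : NCPoly k X} (hf : f ≠ 0) : ∃ w, IsLeadingWord f w := by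
  have hmax : ∀ s : Finset (List X), s.Nonempty → ∃ w ∈ s, ∀ v ∈ s, v = w ∨ DegLexLT v w := by
    intro s hs
    induction hs using Finset.Nonempty.cons_induction with
    | singleton a => exact ⟨a, by simp⟩
    | cons a s ha hs ih =>
      obtain ⟨w, hw, h⟩ := ih
      rcases degLexLT_trichotomy a w with h' | h' | h'
      · refine ⟨w, by simp [hw], fun v hv => ?_⟩
        rcases Finset.mem_cons.1 hv with rfl | hv
        · exact .inr h'
        · exact h v hv
      · exact absurd (h' ▸ hw) ha
      · refine ⟨a, by simp, fun v hv => ?_⟩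
        rcases Finset.mem_cons.1 hv with rfl | hv
        · exact .inl rfl
        · rcases h v hv with rfl | h
          · exact .inr h'
          · exact .inr (h.trans h')
  have hs : (f.coeff.support.map FreeMonoid.toList.toEmbedding).Nonempty := by
    rw [Finset.map_nonempty, Finsupp.support_nonempty_iff]
    simpa using hf
  obtain ⟨w, hw, h⟩ := hmax _ hs
  have hmem : ∀ v, v ∈ f.coeff.support.map FreeMonoid.toList.toEmbedding ↔ wcoeff f v ≠ 0 := by
    intro v
    rw [Finset.mem_map_equiv, Finsupp.mem_support_iff]
    rfl
  exact ⟨w, (hmem w).1 hw, fun v hv => h v ((hmem v).2 hv)⟩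

theorem IsLeadingWord.lead_eq {f : NCPoly k X} {w : List X} (h : IsLeadingWord f w) :
    lead f = w := by
  have h' : ∃ w, IsLeadingWord f w := ⟨w, h⟩
  unfold lead
  rw [dif_pos h']
  exact h'.choose_spec.unique h

theorem HasLead.isLeadingWord {f : NCPoly k X} {w : List X} (h : HasLead f w) :
    IsLeadingWord f w :=
  (hasLead_iff.1 h).2

theorem IsMonic.hasLead {f : NCPoly k X} (h : IsMonic f) : HasLead f (lead f) := by
  have hf : f ≠ 0 := by
    rintro rfl
    simp [IsMonic, wcoeff_zero] at h
  obtain ⟨w, hw⟩ := exists_isLeadingWord hf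
  have e := hw.lead_eq
  exact hasLead_iff.2 ⟨h, e ▸ hw⟩

theorem HasLead.mem_wordSpan_le {f : NCPoly k X} {w : List X} (h : HasLead f w) :
    f ∈ wordSpan k {v | v = w ∨ DegLexLT v w} :=
  mem_wordSpan.2 h.isLeadingWord.2

theorem HasLead.mem_lower {f : NCPoly k X} {v w : List X} (h : HasLead f v) (hv : DegLexLT v w) :
    f ∈ lower k w := by
  refine wordSpan_mono ?_ h.mem_wordSpan_le
  rintro u (rfl | hu)
  · exact hv
  · exact DegLexLT.trans hu hv

theorem HasLead.sub_mem_lower {f g : NCPoly k X} {w : List X} (hf : HasLead f w)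
    (hg : HasLead g w) : f - g ∈ lower k w := by
  have := Submodule.sub_mem _ hf hg
  rwa [sub_sub_sub_cancel_right] at this

theorem HasLead.mul {f g : NCPoly k X} {u v : List X} (hf : HasLead f u) (hg : HasLead g v) :
    HasLead (f * g) (u ++ v) := by
  have h1 : (f - mono k u) * g ∈ lower k (u ++ v) := by
    refine mul_mem_wordSpan ?_ hf hg.mem_wordSpan_le
    rintro a ha b (rfl | hb)
    · exact DegLexLT.append_right ha b
    · exact (DegLexLT.append_right ha b).trans (hb.append_left u)
  have h2 : mono k u * (g - mono k v) ∈ lower k (u ++ v) := by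
    refine mul_mem_wordSpan (P := {u}) ?_ (mono_mem_wordSpan rfl) hg
    rintro a rfl b hb
    exact DegLexLT.append_left hb a
  have e : f * g - mono k (u ++ v) = (f - mono k u) * g + mono k u * (g - mono k v) := by
    rw [mono_append]
    noncomm_ring
  rw [HasLead, e]
  exact Submodule.add_mem _ h1 h2

theorem HasLead.lie {f g : NCPoly k X} {u v : List X} (hf : HasLead f u) (hg : HasLead g v)
    (h : LexLT (v ++ u) (u ++ v)) : HasLead ⁅f, g⁆ (u ++ v) := by
  have h1 := hf.mul hg
  have h2 := (hg.mul hf).mem_lower (w := u ++ v) (.inr ⟨by simp [Nat.add_comm], h⟩)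
  have := Submodule.sub_mem _ h1 h2
  rwa [sub_right_comm] at this

/-- Gaussian elimination along the deg-lex order. If every leading word of an element of the
subspace `A` belongs to `P`, and `A` contains monic polynomials `e w` with leading word `w`,
`w ∈ P`, then these polynomials span `A`; for an element of `A` whose words lie in a set `Q` that is
closed under passing to smaller words, those with `w ∈ Q` suffice. -/
theorem mem_span_of_isLeadingWord [WellFoundedLT X] {A : Submodule k (NCPoly k X)}
    {P : Set (List X)} {e : List X → NCPoly k X} (heA : ∀ w ∈ P, e w ∈ A)
    (he : ∀ w ∈ P, HasLead (e w) w) (hP : ∀ f ∈ A, ∀ w, IsLeadingWord f w → w ∈ P)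
    {Q : Set (List X)} (hQ : ∀ u v, DegLexLT u v → v ∈ Q → u ∈ Q) {f : NCPoly k X} (hf : f ∈ A)
    (hfQ : f ∈ wordSpan k Q) : f ∈ Submodule.span k (e '' (P ∩ Q)) := by
  have key : ∀ w, ∀ f ∈ A, f ∈ wordSpan k Q → IsLeadingWord f w →
      f ∈ Submodule.span k (e '' (P ∩ Q)) := by
    intro w
    induction w using (degLexLT_wellFounded (X := X)).induction with
    | _ w ih =>
      intro f hf hfQ hw
      have hwP := hP f hf w hw
      have hwQ : w ∈ Q := mem_wordSpan.1 hfQ w hw.1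
      have hew := he w hwP
      have heQ : e w ∈ wordSpan k Q := by
        refine wordSpan_mono ?_ hew.mem_wordSpan_le
        rintro v (rfl | hv)
        · exact hwQ
        · exact hQ v w hv hwQ
      set c := wcoeff f w with hc
      have hg : f - c • e w ∈ Submodule.span k (e '' (P ∩ Q)) := by
        by_cases h0 : f - c • e w = 0
        · rw [h0]
          exact zero_mem _
        obtain ⟨w', hw'⟩ := exists_isLeadingWord h0
        refine ih w' ?_ _ (sub_mem hf (Submodule.smul_mem _ _ (heA w hwP)))
          (sub_mem hfQ (Submodule.smul_mem _ _ heQ)) hw'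
        have h1 := hw'.1
        have h2 := (hasLead_iff.1 hew).1
        have h3 : w' ≠ w := by
          rintro rfl
          simp [wcoeff_sub, wcoeff_smul, h2, hc] at h1
        rw [wcoeff_sub, wcoeff_smul] at h1
        by_cases h4 : wcoeff f w' = 0
        · rw [h4, zero_sub, neg_ne_zero] at h1
          exact (hew.isLeadingWord.2 w' (right_ne_zero_of_mul h1)).resolve_left h3
        · exact (hw.2 w' h4).resolve_left h3
      have := Submodule.add_mem _ hg
        (Submodule.smul_mem _ c (Submodule.subset_span ⟨w, ⟨hwP, hwQ⟩, rfl⟩))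
      rwa [sub_add_cancel] at this
  by_cases h0 : f = 0
  · rw [h0]
    exact zero_mem _
  · obtain ⟨w, hw⟩ := exists_isLeadingWord h0
    exact key w f hf hfQ hw

/-- The leading word of a linear combination of monic polynomials with distinct leading words is one
of these words. -/
theorem exists_lead_of_mem_span {ι : Type*} {e : ι → NCPoly k X} {d : ι → List X}
    (hd : Function.Injective d) (he : ∀ i, HasLead (e i) (d i)) {c : ι →₀ k} (hc : c ≠ 0) :
    ∃ i, IsLeadingWord (Finsupp.linearCombination k e c) (d i) := by
  classical
  -- the largest of the words `d i`, `i` in the support of `c`, is the leading word of `∑ cᵢ dᵢ`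
  have hg : (Finsupp.linearCombination k (fun i => mono k (d i)) c) ≠ 0 ∧
      ∀ w, wcoeff (Finsupp.linearCombination k (fun i => mono k (d i)) c) w =
        c.sum fun i a => if d i = w then a else 0 := by
    have h1 : ∀ w, wcoeff (Finsupp.linearCombination k (fun i => mono k (d i)) c) w =
        c.sum fun i a => if d i = w then a else 0 := by
      intro w
      have h2 : wcoeff (Finsupp.linearCombination k (fun i => mono k (d i)) c) w =
          c.sum fun i a => wcoeff (a • mono k (d i)) w := by
        simp [Finsupp.linearCombination_apply, Finsupp.sum, wcoeff]
      rw [h2]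
      simp [wcoeff_smul, wcoeff_mono]
    refine ⟨fun h0 => ?_, h1⟩
    obtain ⟨i, hi⟩ := Finsupp.support_nonempty_iff.2 hc
    have h3 := h1 (d i)
    rw [h0, wcoeff_zero, Finsupp.sum, Finset.sum_eq_single_of_mem i hi] at h3
    · simp only [↓reduceIte] at h3
      exact Finsupp.mem_support_iff.1 hi h3.symm
    · intro j _ hj
      simp [hd.ne hj]
  obtain ⟨w, hw⟩ := exists_isLeadingWord hg.1
  have hcoef : ∀ i ∈ c.support, wcoeff (Finsupp.linearCombination k (fun i => mono k (d i)) c)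
      (d i) ≠ 0 := by
    intro i hi
    rw [hg.2, Finsupp.sum, Finset.sum_eq_single_of_mem i hi]
    · simpa using hi
    · intro j _ hj
      simp [hd.ne hj]
  obtain ⟨i, hi, rfl⟩ : ∃ i ∈ c.support, d i = w := by
    by_contra! h
    refine hw.1 ?_
    rw [hg.2]
    exact Finset.sum_eq_zero fun i hi => if_neg (h i hi)
  refine ⟨i, ?_⟩
  have hdiff : Finsupp.linearCombination k e c -
      Finsupp.linearCombination k (fun i => mono k (d i)) c ∈ lower k (d i) := by
    have h2 : Finsupp.linearCombination k e c -
        Finsupp.linearCombination k (fun i => mono k (d i)) c =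
        ∑ j ∈ c.support, c j • (e j - mono k (d j)) := by
      simp [Finsupp.linearCombination_apply, Finsupp.sum, smul_sub]
    rw [h2]
    refine Submodule.sum_mem _ fun j hj => Submodule.smul_mem _ _ ?_
    rcases hw.2 (d j) (hcoef j hj) with h | h
    · rw [← h]
      exact he j
    · exact lower_mono h (he j)
  have hdiff' := mem_wordSpan.1 hdiff
  simp only [wcoeff_sub, Set.mem_ofPred_eq] at hdiff'
  have hval : ∀ v, ¬ DegLexLT v (d i) → wcoeff (Finsupp.linearCombination k e c) v =
      wcoeff (Finsupp.linearCombination k (fun i => mono k (d i)) c) v := by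
    intro v hv
    by_contra h
    exact hv (hdiff' v (sub_ne_zero.2 h))
  refine ⟨?_, fun v hv => ?_⟩
  · rw [hval _ (DegLexLT.irrefl _)]
    exact hw.1
  · by_cases h : DegLexLT v (d i)
    · exact .inr h
    · rw [hval v h] at hv
      exact hw.2 v hv

theorem linearIndependent_of_hasLead {ι : Type*} {e : ι → NCPoly k X} {d : ι → List X}
    (hd : Function.Injective d) (he : ∀ i, HasLead (e i) (d i)) : LinearIndependent k e := by
  rw [linearIndependent_iff]
  intro c hc
  by_contra h
  obtain ⟨i, hi⟩ := exists_lead_of_mem_span hd he h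
  rw [hc] at hi
  exact hi.1 rfl

end Leading

/-! ### The composition–diamond lemma in `k⟨X⟩` -/

section Diamond

variable {k : Type u} [Field k] {X : Type v} [LinearOrder X]

/-- The span of the polynomials `a s b` with `s ∈ S` and `a s̄ b ∈ Q`. -/
noncomputable def multiples (S : Set (NCPoly k X)) (Q : Set (List X)) :
    Submodule k (NCPoly k X) :=
  Submodule.span k {p : NCPoly k X | ∃ s ∈ S, ∃ a b : List X,
    a ++ lead s ++ b ∈ Q ∧ p = mono k a * s * mono k b}

variable {S : Set (NCPoly k X)}

theorem mul_mem_multiples {Q : Set (List X)} {s : NCPoly k X} (hs : s ∈ S) {a b : List X}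
    (h : a ++ lead s ++ b ∈ Q) : mono k a * s * mono k b ∈ multiples S Q :=
  Submodule.subset_span ⟨s, hs, a, b, h, rfl⟩

theorem multiples_mono {T : Set (NCPoly k X)} {Q R : Set (List X)} (hST : S ⊆ T) (h : Q ⊆ R) :
    multiples S Q ≤ multiples T R := by
  refine Submodule.span_mono ?_
  rintro p ⟨s, hs, a, b, hab, rfl⟩
  exact ⟨s, hST hs, a, b, h hab, rfl⟩

theorem AssocTrivial.of_subset {T : Set (NCPoly k X)} (hST : S ⊆ T) {w : List X} {h : NCPoly k X}
    (hh : AssocTrivial S w h) : AssocTrivial T w h :=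
  multiples_mono (Q := {v | DegLexLT v w}) hST subset_rfl hh

theorem AssocTrivial.mul_mul {w : List X} {h : NCPoly k X} (hh : AssocTrivial S w h)
    (a b : List X) : AssocTrivial S (a ++ w ++ b) (mono k a * h * mono k b) := by
  unfold AssocTrivial at hh
  induction hh using Submodule.span_induction with
  | mem p hp =>
    obtain ⟨s, hs, a', b', hab, rfl⟩ := hp
    refine Submodule.subset_span ⟨s, hs, a ++ a', b' ++ b, ?_, ?_⟩
    · have := (hab.append_left a).append_right b
      simpa using this
    · simp only [mono_append, mul_assoc]
  | zero => simp [AssocTrivial]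
  | add x y _ _ hx hy =>
    rw [mul_add, add_mul]
    exact Submodule.add_mem _ hx hy
  | smul c x _ hx =>
    rw [mul_smul_comm, smul_mul_assoc]
    exact Submodule.smul_mem _ _ hx

theorem mem_span_iff_mem_multiples {f : NCPoly k X} :
    f ∈ TwoSidedIdeal.span S ↔ f ∈ multiples S Set.univ := by
  have hl : ∀ a : List X, ∀ y ∈ multiples S Set.univ, mono k a * y ∈ multiples S Set.univ := by
    intro a y hy
    unfold multiples at hy
    induction hy using Submodule.span_induction with
    | mem p hp =>
      obtain ⟨s, hs, a', b', -, rfl⟩ := hp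
      rw [← mul_assoc, ← mul_assoc, ← mono_append]
      exact mul_mem_multiples hs trivial
    | zero => simp
    | add x y _ _ hx hy =>
      rw [mul_add]
      exact Submodule.add_mem _ hx hy
    | smul c x _ hx =>
      rw [mul_smul_comm]
      exact Submodule.smul_mem _ _ hx
  have hr : ∀ a : List X, ∀ y ∈ multiples S Set.univ, y * mono k a ∈ multiples S Set.univ := by
    intro a y hy
    unfold multiples at hy
    induction hy using Submodule.span_induction with
    | mem p hp =>
      obtain ⟨s, hs, a', b', -, rfl⟩ := hp
      rw [mul_assoc, ← mono_append]
      exact mul_mem_multiples hs trivial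
    | zero => simp
    | add x y _ _ hx hy =>
      rw [add_mul]
      exact Submodule.add_mem _ hx hy
    | smul c x _ hx =>
      rw [smul_mul_assoc]
      exact Submodule.smul_mem _ _ hx
  have hpoly : ∀ x : NCPoly k X, x ∈ Submodule.span k (mono k '' (Set.univ : Set (List X))) := by
    intro x
    have := (wordSpan_univ (k := k) (X := X)).ge (Submodule.mem_top (x := x))
    exact this
  constructor
  · intro hf
    let I : TwoSidedIdeal (NCPoly k X) := TwoSidedIdeal.mk' (multiples S Set.univ)
      (zero_mem _) (fun hx hy => add_mem hx hy) (fun hx => neg_mem hx)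
      (by
        intro x y hy
        have hx := hpoly x
        induction hx using Submodule.span_induction with
        | mem p hp =>
          obtain ⟨a, -, rfl⟩ := hp
          exact hl a y hy
        | zero => simp
        | add x₁ x₂ _ _ h₁ h₂ =>
          rw [add_mul]
          exact Submodule.add_mem _ h₁ h₂
        | smul c x _ hx =>
          rw [smul_mul_assoc]
          exact Submodule.smul_mem _ _ hx)
      (by
        intro y x hy
        have hx := hpoly x
        induction hx using Submodule.span_induction with
        | mem p hp =>
          obtain ⟨a, -, rfl⟩ := hp
          exact hr a y hy
        | zero => simp
        | add x₁ x₂ _ _ h₁ h₂ =>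
          rw [mul_add]
          exact Submodule.add_mem _ h₁ h₂
        | smul c x _ hx =>
          rw [mul_smul_comm]
          exact Submodule.smul_mem _ _ hx)
    have hSI : TwoSidedIdeal.span S ≤ I := by
      rw [TwoSidedIdeal.span_le]
      intro s hs
      have := mul_mem_multiples (Q := Set.univ) hs (a := []) (b := []) trivial
      rw [mono_nil, one_mul, mul_one] at this
      exact (TwoSidedIdeal.mem_mk' ..).2 this
    exact (TwoSidedIdeal.mem_mk' ..).1 (hSI hf)
  · intro hf
    unfold multiples at hf
    induction hf using Submodule.span_induction with
    | mem p hp =>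
      obtain ⟨s, hs, a, b, -, rfl⟩ := hp
      exact TwoSidedIdeal.mul_mem_right _ _ _ (TwoSidedIdeal.mul_mem_left _ _ _
        (TwoSidedIdeal.subset_span hs))
    | zero => exact TwoSidedIdeal.zero_mem _
    | add x y _ _ hx hy => exact TwoSidedIdeal.add_mem _ hx hy
    | smul c x _ hx =>
      rw [← one_mul x, ← smul_mul_assoc]
      exact TwoSidedIdeal.mul_mem_left _ _ _ hx

/-- If `s₁, s₂ ∈ S` have disjoint leading words in `w = s̄₁ c s̄₂`, then `s₁ c s̄₂ - s̄₁ c s₂` is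
trivial. -/
theorem assocTrivial_of_disjoint {s₁ s₂ : NCPoly k X} (h₁ : s₁ ∈ S) (h₂ : s₂ ∈ S)
    (m₁ : IsMonic s₁) (m₂ : IsMonic s₂) (c : List X) :
    AssocTrivial S (lead s₁ ++ c ++ lead s₂)
      (s₁ * mono k (c ++ lead s₂) - mono k (lead s₁ ++ c) * s₂) := by
  have hA : ∀ g ∈ lower k (lead s₂), s₁ * mono k c * g ∈
      multiples S {v | DegLexLT v (lead s₁ ++ c ++ lead s₂)} := by
    intro g hg
    unfold lower wordSpan at hg
    induction hg using Submodule.span_induction with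
    | mem p hp =>
      obtain ⟨v, hv, rfl⟩ := hp
      have := mul_mem_multiples (S := S) (Q := {v | DegLexLT v (lead s₁ ++ c ++ lead s₂)}) h₁
        (a := []) (b := c ++ v) (by simpa using DegLexLT.append_left hv (lead s₁ ++ c))
      rwa [mono_nil, one_mul, mono_append, ← mul_assoc] at this
    | zero => simp
    | add x y _ _ hx hy =>
      rw [mul_add]
      exact Submodule.add_mem _ hx hy
    | smul c x _ hx =>
      rw [mul_smul_comm]
      exact Submodule.smul_mem _ _ hx
  have hB : ∀ g ∈ lower k (lead s₁), g * mono k c * s₂ ∈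
      multiples S {v | DegLexLT v (lead s₁ ++ c ++ lead s₂)} := by
    intro g hg
    unfold lower wordSpan at hg
    induction hg using Submodule.span_induction with
    | mem p hp =>
      obtain ⟨v, hv, rfl⟩ := hp
      have := mul_mem_multiples (S := S) (Q := {v | DegLexLT v (lead s₁ ++ c ++ lead s₂)}) h₂
        (a := v ++ c) (b := []) (by simpa using DegLexLT.append_right hv (c ++ lead s₂))
      rwa [mono_nil, mul_one, mono_append] at this
    | zero => simp
    | add x y _ _ hx hy =>
      rw [add_mul, add_mul]
      exact Submodule.add_mem _ hx hy
    | smul c x _ hx =>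
      rw [smul_mul_assoc, smul_mul_assoc]
      exact Submodule.smul_mem _ _ hx
  have e : s₁ * mono k (c ++ lead s₂) - mono k (lead s₁ ++ c) * s₂ =
      (s₁ - mono k (lead s₁)) * mono k c * s₂ - s₁ * mono k c * (s₂ - mono k (lead s₂)) := by
    simp only [mono_append]
    noncomm_ring
  rw [e]
  exact Submodule.sub_mem _ (hB _ m₁.hasLead) (hA _ m₂.hasLead)

/-- In a Gröbner–Shirshov basis, two multiples with the same leading word `w` differ by an element
that is trivial modulo `w`. -/
theorem IsAssocGSBasis.sub_trivial (hS : IsAssocGSBasis S) (hmonic : ∀ s ∈ S, IsMonic s)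
    {s₁ s₂ : NCPoly k X} (h₁ : s₁ ∈ S) (h₂ : s₂ ∈ S) {a₁ a₂ b₁ b₂ : List X}
    (e : a₁ ++ lead s₁ ++ b₁ = a₂ ++ lead s₂ ++ b₂) :
    AssocTrivial S (a₁ ++ lead s₁ ++ b₁)
      (mono k a₁ * s₁ * mono k b₁ - mono k a₂ * s₂ * mono k b₂) := by
  wlog hle : a₁.length ≤ a₂.length generalizing s₁ s₂ a₁ a₂ b₁ b₂
  · have := this h₂ h₁ e.symm (by omega)
    rw [← e] at this
    rw [← neg_sub]
    exact Submodule.neg_mem _ this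
  obtain ⟨a, rfl⟩ : a₁ <+: a₂ := by
    refine List.prefix_of_prefix_length_le (l₃ := a₁ ++ lead s₁ ++ b₁)
      ⟨lead s₁ ++ b₁, by simp⟩ ⟨lead s₂ ++ b₂, by simp [e]⟩ hle
  have e' : lead s₁ ++ b₁ = a ++ (lead s₂ ++ b₂) := by simpa using e
  -- either the two leading words are disjoint, or they overlap, or one contains the other
  rcases List.append_eq_append_iff.1 e' with ⟨c, rfl, rfl⟩ | ⟨y, hy, hy'⟩
  · have := (assocTrivial_of_disjoint h₁ h₂ (hmonic _ h₁) (hmonic _ h₂) c).mul_mul a₁ b₂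
    convert this using 1
    · simp
    · simp only [mono_append]
      noncomm_ring
  · rcases List.append_eq_append_iff.1 hy' with ⟨b, rfl, rfl⟩ | ⟨b, hb, rfl⟩
    · have := ((hS s₁ h₁ s₂ h₂).2 (lead s₁) a b rfl (by simpa using hy)).mul_mul a₁ b₁
      convert this using 1
      simp only [mono_append]
      noncomm_ring
    · by_cases hy0 : y = []
      · subst hy0
        have := (assocTrivial_of_disjoint h₁ h₂ (hmonic _ h₁) (hmonic _ h₂) []).mul_mul a₁ b₂
        simp only [List.append_nil, List.nil_append] at hy hb
        subst hb
        convert this using 1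
        · simp
        · simp only [mono_append, ← hy, List.append_nil, List.nil_append]
          noncomm_ring
      have hlen := List.length_pos_of_ne_nil hy0
      have := ((hS s₁ h₁ s₂ h₂).1 (lead s₁ ++ b) a b rfl (by rw [hy, hb]; simp) (by
        have h3 := congrArg List.length hy
        have h4 := congrArg List.length hb
        simp only [List.length_append] at *
        omega)).mul_mul a₁ b₂
      convert this using 1
      · simp
      · simp only [mono_append]
        noncomm_ring

/-- An element of the ideal generated by `S` involves a largest word `a s̄ b`. -/
theorem exists_bound_of_mem_multiples {Q : Set (List X)} {f : NCPoly k X}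
    (hf : f ∈ multiples S Q) :
    f = 0 ∨ ∃ w ∈ Q, f ∈ multiples S {v | v = w ∨ DegLexLT v w} := by
  unfold multiples at hf
  induction hf using Submodule.span_induction with
  | mem p hp =>
    obtain ⟨s, hs, a, b, hab, rfl⟩ := hp
    exact .inr ⟨_, hab, mul_mem_multiples hs (.inl rfl)⟩
  | zero => exact .inl rfl
  | add x y _ _ hx hy =>
    rcases hx with rfl | ⟨v, hv, hx⟩
    · rwa [zero_add]
    rcases hy with rfl | ⟨w, hw, hy⟩
    · exact .inr ⟨v, hv, by rwa [add_zero]⟩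
    have hle : ∀ {v w : List X}, DegLexLT v w → multiples S {u | u = v ∨ DegLexLT u v} ≤
        multiples S {u | u = w ∨ DegLexLT u w} := by
      intro v w h
      refine multiples_mono subset_rfl ?_
      rintro u (rfl | hu)
      · exact .inr h
      · exact .inr (DegLexLT.trans hu h)
    rcases degLexLT_trichotomy v w with h | rfl | h
    · exact .inr ⟨w, hw, add_mem (hle h hx) hy⟩
    · exact .inr ⟨v, hv, add_mem hx hy⟩
    · exact .inr ⟨v, hv, add_mem hx (hle h hy)⟩
  | smul c x _ hx =>
    rcases hx with rfl | ⟨v, hv, hx⟩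
    · exact .inl (smul_zero c)
    · exact .inr ⟨v, hv, Submodule.smul_mem _ _ hx⟩

theorem hasLead_mul_mul {s : NCPoly k X} (hs : IsMonic s) (a b : List X) :
    HasLead (mono k a * s * mono k b) (a ++ lead s ++ b) :=
  ((hasLead_mono a).mul hs.hasLead).mul (hasLead_mono b)

theorem multiples_lower_le (hmonic : ∀ s ∈ S, IsMonic s) (w : List X) :
    multiples S {v | DegLexLT v w} ≤ lower k w := by
  refine Submodule.span_le.2 ?_
  rintro p ⟨s, hs, a, b, hab, rfl⟩
  exact (hasLead_mul_mul (hmonic s hs) a b).mem_lower hab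

/-- The words having a subword `s̄` with `s ∈ S`. -/
def reducibleWords (S : Set (NCPoly k X)) : Set (List X) :=
  {w | ∃ s ∈ S, ∃ a b : List X, w = a ++ lead s ++ b}

theorem not_mem_reducibleWords {w : List X} : w ∉ reducibleWords S ↔ IsIrr S w := by
  simp [reducibleWords, IsIrr]

/-- Composition–diamond lemma: the leading words of the elements of the ideal generated by a
Gröbner–Shirshov basis `S` are not `S`-irreducible. -/
theorem IsAssocGSBasis.lead_mem [WellFoundedLT X] (hS : IsAssocGSBasis S)
    (hmonic : ∀ s ∈ S, IsMonic s) {f : NCPoly k X} (hf : f ∈ TwoSidedIdeal.span S) {w : List X}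
    (hw : IsLeadingWord f w) : w ∈ reducibleWords S := by
  -- induction on a word `v` such that `f` is a combination of `a s b` with `a s̄ b ≤ v`
  have key : ∀ v, ∀ f ∈ multiples S {u | u = v ∨ DegLexLT u v}, ∀ w, IsLeadingWord f w →
      w ∈ reducibleWords S := by
    intro v
    induction v using (degLexLT_wellFounded (X := X)).induction with
    | _ v ih =>
      intro f hf w hw
      have hlow : f ∈ multiples S {u | DegLexLT u v} → w ∈ reducibleWords S := by
        intro h
        rcases exists_bound_of_mem_multiples h with rfl | ⟨v', hv', h'⟩
        · exact absurd rfl hw.1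
        · exact ih v' hv' f h' w hw
      by_cases hv : v ∈ reducibleWords S
      · obtain ⟨s, hs, a, b, rfl⟩ := hv
        have hdec : ∃ c : k, f - c • (mono k a * s * mono k b) ∈
            multiples S {u | DegLexLT u (a ++ lead s ++ b)} := by
          unfold multiples at hf
          clear hlow hw
          induction hf using Submodule.span_induction with
          | mem p hp =>
            obtain ⟨s', hs', a', b', h | h, rfl⟩ := hp
            · refine ⟨1, ?_⟩
              rw [one_smul, ← h]
              exact hS.sub_trivial hmonic hs' hs h
            · refine ⟨0, ?_⟩
              rw [zero_smul, sub_zero]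
              exact mul_mem_multiples hs' h
          | zero => exact ⟨0, by simp⟩
          | add x y _ _ hx hy =>
            obtain ⟨c, hc⟩ := hx
            obtain ⟨d, hd⟩ := hy
            refine ⟨c + d, ?_⟩
            rw [add_smul, add_sub_add_comm]
            exact add_mem hc hd
          | smul r x _ hx =>
            obtain ⟨c, hc⟩ := hx
            refine ⟨r * c, ?_⟩
            rw [mul_smul, ← smul_sub]
            exact Submodule.smul_mem _ _ hc
        obtain ⟨c, hc⟩ := hdec
        by_cases hc0 : c = 0
        · rw [hc0, zero_smul, sub_zero] at hc
          exact hlow hc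
        · -- the coefficient `c` of `a s b` survives, so that `a s̄ b` is the leading word
          have h1 := multiples_lower_le hmonic _ hc
          have h2 := hasLead_iff.1 (hasLead_mul_mul (hmonic s hs) a b)
          have h3 := mem_wordSpan.1 h1
          have h4 : wcoeff f (a ++ lead s ++ b) ≠ 0 := by
            intro h0
            refine DegLexLT.irrefl _ (h3 (a ++ lead s ++ b) ?_)
            rw [wcoeff_sub, wcoeff_smul, h2.1, h0]
            simpa using hc0
          rcases hw.2 _ h4 with h5 | h5
          · exact ⟨s, hs, a, b, h5.symm⟩
          · exfalso
            have h6 : wcoeff (mono k a * s * mono k b) w = 0 := by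
              by_contra h6
              rcases h2.2.2 w h6 with h7 | h7
              · exact DegLexLT.irrefl _ (h7 ▸ h5)
              · exact DegLexLT.irrefl _ (h5.trans h7)
            have h7 := h3 w (by rw [wcoeff_sub, wcoeff_smul, h6, mul_zero, sub_zero]; exact hw.1)
            exact DegLexLT.irrefl _ (h5.trans h7)
      · refine hlow ?_
        have h1 : f ∈ multiples S {u | u = v ∨ DegLexLT u v} := hf
        refine (Submodule.span_mono ?_ : multiples S _ ≤ multiples S _) h1
        rintro p ⟨s, hs, a, b, h | h, rfl⟩
        · exact absurd ⟨s, hs, a, b, h.symm⟩ hv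
        · exact ⟨s, hs, a, b, h, rfl⟩
  rcases exists_bound_of_mem_multiples (mem_span_iff_mem_multiples.1 hf) with rfl | ⟨v, -, h⟩
  · exact absurd rfl hw.1
  · exact key v f h w hw

variable (S) in
/-- The ideal of `k⟨X⟩` generated by `S`, as a subspace. -/
noncomputable def idealSubmodule : Submodule k (NCPoly k X) := multiples S Set.univ

theorem mem_idealSubmodule {f : NCPoly k X} :
    f ∈ idealSubmodule S ↔ f ∈ TwoSidedIdeal.span S :=
  mem_span_iff_mem_multiples.symm

open Classical in
variable (S) in
/-- A multiple `a s b` with `a s̄ b = w` if there is one, and the word `w` itself otherwise. -/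
noncomputable def multipleAt (w : List X) : NCPoly k X :=
  if h : ∃ s ∈ S, ∃ a b : List X, w = a ++ lead s ++ b then
    mono k h.choose_spec.2.choose * h.choose * mono k h.choose_spec.2.choose_spec.choose
  else mono k w

theorem multipleAt_spec {w : List X} (hw : w ∈ reducibleWords S) :
    ∃ s ∈ S, ∃ a b : List X, w = a ++ lead s ++ b ∧
      multipleAt S w = mono k a * s * mono k b := by
  have h : ∃ s ∈ S, ∃ a b : List X, w = a ++ lead s ++ b := hw
  refine ⟨h.choose, h.choose_spec.1, h.choose_spec.2.choose,
    h.choose_spec.2.choose_spec.choose, h.choose_spec.2.choose_spec.choose_spec, ?_⟩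
  rw [multipleAt, dif_pos h]

/-- An element of the ideal generated by a Gröbner–Shirshov basis all of whose words are smaller
than `w` is trivial modulo `w`. -/
theorem IsAssocGSBasis.assocTrivial [WellFoundedLT X] (hS : IsAssocGSBasis S)
    (hmonic : ∀ s ∈ S, IsMonic s) {f : NCPoly k X} (hf : f ∈ TwoSidedIdeal.span S) {w : List X}
    (hw : f ∈ lower k w) : AssocTrivial S w f := by
  have h := mem_span_of_isLeadingWord (A := idealSubmodule S) (P := reducibleWords S)
    (e := multipleAt S) (Q := {v | DegLexLT v w}) ?_ ?_ ?_ (fun u v h h' => DegLexLT.trans h h')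
    (mem_idealSubmodule.2 hf) hw
  · refine Submodule.span_le.2 ?_ h
    rintro _ ⟨v, ⟨hv, hvw⟩, rfl⟩
    obtain ⟨s, hs, a, b, rfl, e⟩ := multipleAt_spec hv
    rw [e]
    exact mul_mem_multiples (Q := {v | DegLexLT v w}) hs hvw
  · intro v hv
    obtain ⟨s, hs, a, b, rfl, e⟩ := multipleAt_spec hv
    rw [e]
    exact mul_mem_multiples hs trivial
  · intro v hv
    obtain ⟨s, hs, a, b, rfl, e⟩ := multipleAt_spec hv
    rw [e]
    exact hasLead_mul_mul (hmonic s hs) a b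
  · intro f hf v hv
    exact hS.lead_mem hmonic (mem_idealSubmodule.1 hf) hv

/-- A single monic polynomial whose leading word is a Lyndon–Shirshov word is a Gröbner–Shirshov
basis, because its leading word has no proper overlaps with itself. -/
theorem isAssocGSBasis_singleton {s : NCPoly k X} (h : IsALSW (lead s)) :
    IsAssocGSBasis {s} := by
  rintro f rfl g rfl
  constructor
  · intro w a b e1 e2 hl
    by_cases hb : b = []
    · subst hb
      have ha : a = [] := by
        have := congrArg List.length (e1.symm.trans e2)
        simp only [List.length_append, List.length_nil] at this
        exact List.length_eq_zero_iff.1 (by omega)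
      subst ha
      simp [AssocTrivial, mono_nil]
    · exfalso
      rw [e1] at e2
      rcases List.append_eq_append_iff.1 e2 with ⟨t, h1, h2⟩ | ⟨t, h1, h2⟩
      · -- `a = s̄ t` is excluded by the length condition
        have h3 := congrArg List.length h2
        have h4 := congrArg List.length e1
        simp only [List.length_append] at h3 h4
        have h5 := List.length_pos_of_ne_nil hb
        omega
      · have ha : a ≠ [] := by
          rintro rfl
          simp only [List.nil_append] at h1
          rw [h1] at h2
          exact hb (by simpa using h2)
        have ht : t ≠ [] := by
          rintro rfl
          have h3 := congrArg List.length h2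
          have h4 := congrArg List.length e1
          simp only [List.length_append, List.length_nil] at h3 h4
          omega
        rw [h1] at h
        exact h.not_border ha ht (h1.symm.trans h2)
  · intro w a b e1 e2
    have := congrArg List.length (e1.symm.trans e2)
    simp only [List.length_append] at this
    obtain rfl : a = [] := List.length_eq_zero_iff.1 (by omega)
    obtain rfl : b = [] := List.length_eq_zero_iff.1 (by omega)
    simp [AssocTrivial, mono_nil]

end Diamond

/-! ### The Lie monomials of Lyndon–Shirshov words -/

section FreeLie

variable {k : Type u} [Field k] {X : Type v} [LinearOrder X]

theorem lsBracket_singleton (x : X) : lsBracket k [x] = mono k [x] := by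
  rw [lsBracket]

theorem lsBracket_eq {w : List X} (h : 2 ≤ w.length) :
    lsBracket k w = ⁅lsBracket k (stdLeft w), lsBracket k (stdRight w)⁆ := by
  match w with
  | [] => simp at h
  | [x] => simp at h
  | x :: y :: l => rw [lsBracket]

omit [LinearOrder X] in
theorem exists_eq_singleton {w : List X} (h0 : w ≠ []) (h : ¬ 2 ≤ w.length) : ∃ x, w = [x] :=
  List.length_eq_one_iff.1 (by have := List.length_pos_of_ne_nil h0; omega)

theorem hasLead_lsBracket {w : List X} (hw : IsALSW w) : HasLead (lsBracket k w) w := by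
  induction hn : w.length using Nat.strong_induction_on generalizing w with
  | _ n ih =>
    subst hn
    by_cases h : 2 ≤ w.length
    · have h1 := ih _ (stdLeft_length_lt w h) (isALSW_stdLeft hw h) rfl
      have h2 := ih _ (stdRight_length_lt w h) (isALSW_stdRight h) rfl
      have e := stdLeft_append_stdRight w
      rw [lsBracket_eq h]
      have h3 := h1.lie h2 (by
        rw [← e] at hw
        exact hw.rotate_lt (stdLeft_ne_nil h) (isALSW_stdRight h).ne_nil)
      rwa [e] at h3
    · obtain ⟨x, rfl⟩ := exists_eq_singleton hw.ne_nil h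
      rw [lsBracket_singleton]
      exact hasLead_mono _

theorem lieMonomial_lsBracket {w : List X} (hw : w ≠ []) : LieMonomial w (lsBracket k w) := by
  induction hn : w.length using Nat.strong_induction_on generalizing w with
  | _ n ih =>
    subst hn
    by_cases h : 2 ≤ w.length
    · have h1 := ih _ (stdLeft_length_lt w h) (stdLeft_ne_nil h) rfl
      have h2 := ih _ (stdRight_length_lt w h) (isALSW_stdRight h).ne_nil rfl
      have h3 := h1.bracket h2
      rwa [stdLeft_append_stdRight, ← lsBracket_eq h] at h3
    · obtain ⟨x, rfl⟩ := exists_eq_singleton hw h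
      rw [lsBracket_singleton]
      exact .letter x

variable (k) in
/-- The span of the Lie monomials `[w]`, where `w ⪯ z` is a Lyndon–Shirshov word of the same length
as `z`. -/
noncomputable def bracketsLE (z : List X) : Submodule k (NCPoly k X) :=
  Submodule.span k (lsBracket k '' {w | IsALSW w ∧ w.length = z.length ∧ LexLE w z})

theorem bracketsLE_mono {y z : List X} (hl : y.length = z.length) (h : LexLE y z) :
    bracketsLE k y ≤ bracketsLE k z := by
  refine Submodule.span_mono (Set.image_mono ?_)
  rintro w ⟨h1, h2, h3⟩
  exact ⟨h1, h2.trans hl, h3.trans h⟩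

theorem lie_mem_of_mem_bracketsLE {z : List X} {M : Submodule k (NCPoly k X)} {f g : NCPoly k X}
    (hf : f ∈ bracketsLE k z)
    (h : ∀ w, IsALSW w → w.length = z.length → LexLE w z → ⁅lsBracket k w, g⁆ ∈ M) :
    ⁅f, g⁆ ∈ M := by
  unfold bracketsLE at hf
  induction hf using Submodule.span_induction with
  | mem p hp =>
    obtain ⟨w, ⟨h1, h2, h3⟩, rfl⟩ := hp
    exact h w h1 h2 h3
  | zero => simp
  | add x y _ _ hx hy =>
    rw [add_lie]
    exact add_mem hx hy
  | smul c x _ hx =>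
    rw [smul_lie]
    exact Submodule.smul_mem _ _ hx

/-- The bracket `[[u], [v]]` of Lyndon–Shirshov words `u ≻ v` is a combination of Lie monomials
`[w]` with `w ⪯ uv`. If `(u, v)` is not a standard factorization, then `u = u₁ u₂` with `u₂ ≻ v`,
and one rewrites `[[u₁ u₂] v] = [[u₁ v] u₂] + [u₁ [u₂ v]]`; in the new brackets the product of
the two words is smaller than `uv`, or it is `uv` and the left factor is shorter. -/
theorem lie_lsBracket_mem [WellFoundedLT X] {u v : List X} (hu : IsALSW u) (hv : IsALSW v)
    (huv : LexLT v u) : ⁅lsBracket k u, lsBracket k v⁆ ∈ bracketsLE k (u ++ v) := by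
  suffices key : ∀ z : List X, ∀ n : ℕ, ∀ u v : List X, IsALSW u → IsALSW v → LexLT v u →
      u ++ v = z → u.length = n → ⁅lsBracket k u, lsBracket k v⁆ ∈ bracketsLE k z from
    key _ _ u v hu hv huv rfl rfl
  clear hu hv huv u v
  intro z
  induction z using (degLexLT_wellFounded (X := X)).induction with
  | _ z ihz =>
    intro n
    induction n using Nat.strong_induction_on with
    | _ n ihn =>
      rintro u v hu hv huv rfl rfl
      have hupos := hu.length_pos
      have hvpos := hv.length_pos
      have h2 : 2 ≤ (u ++ v).length := by
        simp only [List.length_append]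
        omega
      by_cases hstd : 2 ≤ u.length → LexLE (stdRight u) v
      · have h3 := stdRight_append hu hv hstd
        have h4 : lsBracket k (u ++ v) = ⁅lsBracket k u, lsBracket k v⁆ := by
          rw [lsBracket_eq h2, h3, stdLeft_append h3]
        rw [← h4]
        exact Submodule.subset_span ⟨u ++ v, ⟨hu.append hv huv, rfl, .inl rfl⟩, rfl⟩
      rw [Classical.not_imp] at hstd
      obtain ⟨hu2, hstd⟩ := hstd
      have hvu₂ : LexLT v (stdRight u) := (lexLE_or_lt _ _).resolve_left hstd
      rw [lsBracket_eq hu2]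
      have hu₂ := isALSW_stdRight hu2
      have hu₁ := isALSW_stdLeft hu hu2
      have hu₂u₁ := stdRight_lt_stdLeft hu hu2
      have e := stdLeft_append_stdRight u
      generalize stdLeft u = u₁ at *
      generalize stdRight u = u₂ at *
      subst e
      have hl₁ := hu₁.length_pos
      have hl₂ := hu₂.length_pos
      have hvu₁ := hvu₂.trans hu₂u₁
      have hJ : ∀ x y z : NCPoly k X, ⁅⁅x, y⁆, z⁆ = ⁅x, ⁅y, z⁆⁆ + ⁅⁅x, z⁆, y⁆ := by
        intro x y z
        simp only [Ring.lie_def]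
        noncomm_ring
      rw [hJ]
      have hA : ⁅lsBracket k u₁, ⁅lsBracket k u₂, lsBracket k v⁆⁆ ∈
          bracketsLE k (u₁ ++ u₂ ++ v) := by
        have h1 := ihz (u₂ ++ v) (.inl (by simp only [List.length_append]; omega)) _ u₂ v hu₂ hv
          hvu₂ rfl rfl
        rw [← lie_skew]
        refine neg_mem (lie_mem_of_mem_bracketsLE h1 fun w hw hwl hwle => ?_)
        rw [← lie_skew]
        refine neg_mem ?_
        have hwu₁ : LexLT w u₁ :=
          (hwle.trans (lexLE_append_self u₂ v)).trans_lt hu₂u₁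
        rcases hwle with rfl | hwlt
        · exact ihn u₁.length (by simp only [List.length_append]; omega) u₁ (u₂ ++ v) hu₁ hw hwu₁
            (by simp) rfl
        · have h3 : LexLT (u₁ ++ w) (u₁ ++ u₂ ++ v) := by
            rw [List.append_assoc, lexLT_append_left_iff]
            exact hwlt
          have h4 : (u₁ ++ w).length = (u₁ ++ u₂ ++ v).length := by simp [hwl]
          exact bracketsLE_mono h4 (.inr h3) (ihz _ (.inr ⟨h4, h3⟩) _ u₁ w hu₁ hw hwu₁ rfl rfl)
      have hB : ⁅⁅lsBracket k u₁, lsBracket k v⁆, lsBracket k u₂⁆ ∈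
          bracketsLE k (u₁ ++ u₂ ++ v) := by
        have h1 := ihz (u₁ ++ v) (.inl (by simp only [List.length_append]; omega)) _ u₁ v hu₁ hv
          hvu₁ rfl rfl
        refine lie_mem_of_mem_bracketsLE h1 fun w hw hwl hwle => ?_
        rcases lexLT_trichotomy w u₂ with h | rfl | h
        · rw [← lie_skew]
          refine neg_mem ?_
          have h3 : LexLT (u₂ ++ w) (u₁ ++ u₂ ++ v) :=
            (hu.suffix_lt hu₁.ne_nil hu₂.ne_nil).append (by simp) w v
          have h4 : (u₂ ++ w).length = (u₁ ++ u₂ ++ v).length := by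
            simp only [List.length_append, hwl]
            omega
          exact bracketsLE_mono h4 (.inr h3) (ihz _ (.inr ⟨h4, h3⟩) _ u₂ w hu₂ hw h rfl rfl)
        · simp
        · have h3 : LexLT (w ++ u₂) (u₁ ++ u₂ ++ v) := by
            have h5 : LexLE (w ++ u₂) (u₁ ++ v ++ u₂) := by
              rcases hwle with rfl | hwlt
              · exact .inl rfl
              · exact .inr (hwlt.append hwl.le _ _)
            refine h5.trans_lt ?_
            rw [List.append_assoc, List.append_assoc, lexLT_append_left_iff]
            exact (hu₂.append hv hvu₂).rotate_lt hu₂.ne_nil hv.ne_nil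
          have h4 : (w ++ u₂).length = (u₁ ++ u₂ ++ v).length := by
            simp only [List.length_append, hwl]
            omega
          exact bracketsLE_mono h4 (.inr h3) (ihz _ (.inr ⟨h4, h3⟩) _ w u₂ hw hu₂ h rfl rfl)
      exact add_mem hA hB

/-- The Lie monomials `[w]` of the Lyndon–Shirshov words `w` span `Lie(X)`. -/
theorem freeLie_le_span [WellFoundedLT X] {f : NCPoly k X} (hf : f ∈ freeLie k X) :
    f ∈ Submodule.span k (Set.range fun w : {w : List X // IsALSW w} => lsBracket k w.1) := by
  set V := Submodule.span k (Set.range fun w : {w : List X // IsALSW w} => lsBracket k w.1)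
    with hV
  have hle : ∀ z, bracketsLE k z ≤ V := by
    intro z
    refine Submodule.span_mono ?_
    rintro _ ⟨w, hw, rfl⟩
    exact ⟨⟨w, hw.1⟩, rfl⟩
  have hgen : ∀ u v : List X, IsALSW u → IsALSW v → ⁅lsBracket k u, lsBracket k v⁆ ∈ V := by
    intro u v hu hv
    rcases lexLT_trichotomy u v with h | rfl | h
    · rw [← lie_skew]
      exact neg_mem (hle _ (lie_lsBracket_mem hv hu h))
    · simp
    · exact hle _ (lie_lsBracket_mem hu hv h)
  have hlie : ∀ x ∈ V, ∀ y ∈ V, ⁅x, y⁆ ∈ V := by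
    intro x hx y hy
    induction hx using Submodule.span_induction with
    | mem p hp =>
      obtain ⟨u, rfl⟩ := hp
      induction hy using Submodule.span_induction with
      | mem q hq =>
        obtain ⟨v, rfl⟩ := hq
        exact hgen u.1 v.1 u.2 v.2
      | zero => simp
      | add x y _ _ hx hy =>
        rw [lie_add]
        exact add_mem hx hy
      | smul c x _ hx =>
        rw [lie_smul]
        exact Submodule.smul_mem _ _ hx
    | zero => simp
    | add x y _ _ hx hy =>
      rw [add_lie]
      exact add_mem hx hy
    | smul c x _ hx =>
      rw [smul_lie]
      exact Submodule.smul_mem _ _ hx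
  let L : LieSubalgebra k (NCPoly k X) := { V with lie_mem' := fun hx hy => hlie _ hx _ hy }
  have h1 : freeLie k X ≤ L := by
    refine LieSubalgebra.lieSpan_le.2 ?_
    rintro _ ⟨x, rfl⟩
    exact Submodule.subset_span ⟨⟨[x], isALSW_singleton x⟩, lsBracket_singleton x⟩
  exact h1 hf

/-- The leading word of a Lie polynomial is a Lyndon–Shirshov word. -/
theorem isALSW_of_isLeadingWord [WellFoundedLT X] {f : NCPoly k X} (hf : f ∈ freeLie k X)
    {w : List X} (hw : IsLeadingWord f w) : IsALSW w := by
  obtain ⟨c, rfl⟩ := Finsupp.mem_span_range_iff_exists_finsupp.1 (freeLie_le_span hf)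
  rw [← Finsupp.linearCombination_apply] at hw
  have hc : c ≠ 0 := by
    rintro rfl
    rw [map_zero] at hw
    exact hw.1 rfl
  obtain ⟨i, hi⟩ := exists_lead_of_mem_span Subtype.val_injective
    (fun w : {w : List X // IsALSW w} => hasLead_lsBracket (k := k) w.2) hc
  rw [hw.unique hi]
  exact i.2

theorem isALSW_lead [WellFoundedLT X] {s : NCPoly k X} (hs : s ∈ freeLie k X) (hm : IsMonic s) :
    IsALSW (lead s) :=
  isALSW_of_isLeadingWord hs hm.hasLead.isLeadingWord

end FreeLie

/-! ### Special normal words -/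

section Special

variable {k : Type u} [Field k] {X : Type v} [LinearOrder X]

omit [LinearOrder X] in
theorem LieMonomial.mem_freeLie {w : List X} {p : NCPoly k X} (h : LieMonomial w p) :
    p ∈ freeLie k X := by
  induction h with
  | letter x => exact LieSubalgebra.subset_lieSpan ⟨x, rfl⟩
  | bracket _ _ h1 h2 => exact (freeLie k X).lie_mem h1 h2

omit [LinearOrder X] in
theorem LieSWord.mem_freeLie {s p : NCPoly k X} (hs : s ∈ freeLie k X) {a b : List X}
    (h : LieSWord s a b p) : p ∈ freeLie k X := by
  induction h with
  | base => exact hs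
  | left hq _ ih => exact (freeLie k X).lie_mem hq.mem_freeLie ih
  | right _ hq ih => exact (freeLie k X).lie_mem ih hq.mem_freeLie

omit [LinearOrder X] in
theorem LieSWord.mem_span {s p : NCPoly k X} {a b : List X} (h : LieSWord s a b p) :
    p ∈ TwoSidedIdeal.span {s} := by
  induction h with
  | base => exact TwoSidedIdeal.subset_span rfl
  | left _ _ ih =>
    exact TwoSidedIdeal.sub_mem _ (TwoSidedIdeal.mul_mem_left _ _ _ ih)
      (TwoSidedIdeal.mul_mem_right _ _ _ ih)
  | right _ _ ih =>
    exact TwoSidedIdeal.sub_mem _ (TwoSidedIdeal.mul_mem_right _ _ _ ih)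
      (TwoSidedIdeal.mul_mem_left _ _ _ ih)

omit [LinearOrder X] in
theorem LieSWord.exists_mem_lieIdeal {S : Set (NCPoly k X)} {s p : NCPoly k X} (hs : s ∈ S)
    (hsL : s ∈ freeLie k X) {a b : List X} (h : LieSWord s a b p) :
    ∃ x ∈ lieIdeal S, (x : NCPoly k X) = p := by
  induction h with
  | base =>
    have h1 : (⟨s, hsL⟩ : freeLie k X) ∈ {p : freeLie k X | (p : NCPoly k X) ∈ S} := hs
    exact ⟨⟨s, hsL⟩, LieSubmodule.subset_lieSpan h1, rfl⟩
  | left hq _ ih =>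
    obtain ⟨x, hx, rfl⟩ := ih
    have h1 := LieSubmodule.lie_mem (lieIdeal S) (x := ⟨_, hq.mem_freeLie⟩) hx
    exact ⟨_, h1, LieSubalgebra.coe_bracket ..⟩
  | right _ hq ih =>
    obtain ⟨x, hx, rfl⟩ := ih
    have h1 := LieSubmodule.lie_mem (lieIdeal S) (x := ⟨_, hq.mem_freeLie⟩) hx
    refine ⟨_, neg_mem h1, ?_⟩
    rw [NegMemClass.coe_neg, LieSubalgebra.coe_bracket, lie_skew]

omit [LinearOrder X] in
theorem mem_span_of_mem_lieIdeal {S : Set (NCPoly k X)} {x : freeLie k X}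
    (hx : x ∈ lieIdeal S) : (x : NCPoly k X) ∈ TwoSidedIdeal.span S := by
  let I : LieIdeal k (freeLie k X) :=
    { carrier := {y | (y : NCPoly k X) ∈ TwoSidedIdeal.span S}
      zero_mem' := TwoSidedIdeal.zero_mem (TwoSidedIdeal.span S)
      add_mem' := fun h1 h2 => TwoSidedIdeal.add_mem (TwoSidedIdeal.span S) h1 h2
      smul_mem' := fun c y hy => by
        have h := TwoSidedIdeal.mul_mem_left (TwoSidedIdeal.span S) (c • (1 : NCPoly k X)) _ hy
        rwa [smul_mul_assoc, one_mul] at h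
      lie_mem := fun {y z} hz => by
        have h1 := TwoSidedIdeal.mul_mem_left (TwoSidedIdeal.span S) (y : NCPoly k X) _ hz
        have h2 := TwoSidedIdeal.mul_mem_right (TwoSidedIdeal.span S) _ (y : NCPoly k X) hz
        exact TwoSidedIdeal.sub_mem _ h1 h2 }
  have h1 : lieIdeal S ≤ I :=
    LieSubmodule.lieSpan_le.2 fun y hy => TwoSidedIdeal.subset_span hy
  exact h1 hx

theorem LieSWord.foldl {s q : NCPoly k X} {a b : List X} (h : LieSWord s a b q)
    {cs : List (List X)} (hcs : ∀ c ∈ cs, c ≠ []) :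
    LieSWord s a (b ++ cs.flatten) (cs.foldl (fun q c => ⁅q, lsBracket k c⁆) q) := by
  induction cs generalizing b q with
  | nil => simpa using h
  | cons c cs ih =>
    have h1 := h.right (lieMonomial_lsBracket (hcs c (by simp)))
    have h2 := ih h1 fun d hd => hcs d (by simp [hd])
    simpa using h2

theorem HasLead.foldl {q : NCPoly k X} {u : List X} (h : HasLead q u) (hu : IsALSW u)
    {cs : List (List X)} (hcs : IsShirshovList cs) (hw : IsALSW (u ++ cs.flatten)) :
    HasLead (cs.foldl (fun q c => ⁅q, lsBracket k c⁆) q) (u ++ cs.flatten) := by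
  induction cs generalizing u q with
  | nil => simpa using h
  | cons c cs ih =>
    obtain ⟨-, h2⟩ := hu.append_factor hcs hw
    have hc := isShirshovList_cons.1 hcs
    have h3 := h.lie (hasLead_lsBracket hc.1) (h2.rotate_lt hu.ne_nil hc.1.ne_nil)
    have h4 := ih h3 h2 hc.2.2 (by simpa using hw)
    simpa using h4

/-- The special bracketing `[a u b]_u`, with `[u]` replaced by a monic polynomial with leading word
`u`, is a Lie bracketing of `a u b`, and it is monic with leading word `a u b`. -/
theorem specialBracket_spec {a u b : List X} {p : NCPoly k X} (hw : IsALSW (a ++ u ++ b))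
    (hu : IsALSW u) (hp : HasLead p u) :
    HasLead (specialBracket a u b p) (a ++ u ++ b) ∧ LieSWord p a b (specialBracket a u b p) := by
  induction hn : a.length + b.length using Nat.strong_induction_on generalizing a b with
  | _ n ih =>
    subst hn
    rw [specialBracket]
    split
    · rename_i h
      obtain ⟨rfl, rfl⟩ := h
      exact ⟨by simpa using hp, .base⟩
    rename_i hab
    have hupos := hu.length_pos
    have h2 : 2 ≤ (a ++ u ++ b).length := by
      have : a.length + b.length ≠ 0 := fun h0 =>
        hab ⟨List.length_eq_zero_iff.1 (by omega), List.length_eq_zero_iff.1 (by omega)⟩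
      simp only [List.length_append]
      omega
    rw [if_neg (by omega)]
    have e := stdLeft_append_stdRight (a ++ u ++ b)
    have hL := isALSW_stdLeft hw h2
    have hR := isALSW_stdRight h2
    have hLR : LexLT (stdRight (a ++ u ++ b) ++ stdLeft (a ++ u ++ b)) (a ++ u ++ b) := by
      rw [← e] at hw
      have := hw.rotate_lt hL.ne_nil hR.ne_nil
      rwa [e] at this
    split
    · -- the marked word lies in the left standard factor
      rename_i h3
      obtain ⟨b', hb'⟩ : ∃ b', stdLeft (a ++ u ++ b) = a ++ u ++ b' := by
        obtain ⟨t, ht⟩ := List.prefix_of_prefix_length_le (l₁ := a ++ u) ⟨b, rfl⟩ ⟨_, e⟩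
          (by simpa using h3)
        exact ⟨t, ht.symm⟩
      have hb : b = b' ++ stdRight (a ++ u ++ b) := by
        have e' := e
        rw [hb'] at e'
        simpa only [List.append_assoc, List.append_cancel_left_eq] using e'.symm
      generalize stdRight (a ++ u ++ b) = r at *
      generalize stdLeft (a ++ u ++ b) = l at *
      subst hb' hb
      have htake : (b' ++ r).take ((a ++ u ++ b').length - (a.length + u.length)) = b' := by
        have : (a ++ u ++ b').length - (a.length + u.length) = b'.length := by
          simp only [List.length_append]
          omega
        rw [this]
        simp
      rw [htake]
      have hrpos := hR.length_pos
      obtain ⟨h5, h6⟩ := ih (a.length + b'.length)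
        (by simp only [List.length_append]; omega) hL rfl
      have h7 := h5.lie (hasLead_lsBracket hR) (by rwa [e])
      rw [e] at h7
      exact ⟨h7, h6.right (lieMonomial_lsBracket hR.ne_nil)⟩
    · rename_i h3
      split
      · -- the marked word lies in the right standard factor
        rename_i h4
        obtain ⟨a', ha'⟩ : ∃ a', a = stdLeft (a ++ u ++ b) ++ a' := by
          obtain ⟨t, ht⟩ := List.prefix_of_prefix_length_le (l₂ := a) ⟨_, e⟩
            ⟨u ++ b, by simp⟩ h4
          exact ⟨t, ht.symm⟩
        have hr : stdRight (a ++ u ++ b) = a' ++ u ++ b := by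
          have e' : stdLeft (a ++ u ++ b) ++ stdRight (a ++ u ++ b) =
              stdLeft (a ++ u ++ b) ++ (a' ++ u ++ b) := by
            rw [e, ← List.append_assoc, ← List.append_assoc, ← ha']
          exact List.append_cancel_left e'
        generalize stdRight (a ++ u ++ b) = r at *
        generalize stdLeft (a ++ u ++ b) = l at *
        subst hr ha'
        have hlpos := hL.length_pos
        rw [List.drop_left]
        obtain ⟨h5, h6⟩ := ih (a'.length + b.length)
          (by simp only [List.length_append]; omega) hR rfl
        have h7 := (hasLead_lsBracket hL).lie h5 (by rwa [e])
        rw [e] at h7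
        exact ⟨h7, h6.left (lieMonomial_lsBracket hL.ne_nil)⟩
      · -- the marked word meets both factors, hence `a = 1`
        rename_i h4
        obtain rfl := eq_nil_of_straddle hu h2 (by omega) (by omega)
        obtain ⟨hc, hce⟩ := shirshovFactors_spec b
        have hne : ∀ c ∈ shirshovFactors b, c ≠ [] := fun c hc' => (hc.1 c hc').ne_nil
        generalize shirshovFactors b = c at *
        subst hce
        rw [List.nil_append] at hw ⊢
        refine ⟨hp.foldl hu hc hw, ?_⟩
        have := (LieSWord.base (s := p)).foldl hne
        simpa using this

theorem specialNormal_spec {a b : List X} {s : NCPoly k X} (hm : IsMonic s)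
    (hs : IsALSW (lead s)) (hw : IsALSW (a ++ lead s ++ b)) :
    HasLead (specialNormal a s b) (a ++ lead s ++ b) ∧ LieSWord s a b (specialNormal a s b) :=
  specialBracket_spec hw hs hm.hasLead

end Special

/-! ### Linear bases of `k⟨X | S⟩` -/

section Bases

variable {k : Type u} [Field k]

theorem IsLinearBasis.comp_equiv_iff {ι ι' M : Type*} [AddCommGroup M] [Module k M] (e : ι ≃ ι')
    (v : ι' → M) : IsLinearBasis k (v ∘ e) ↔ IsLinearBasis k v := by
  rw [IsLinearBasis, IsLinearBasis, linearIndependent_equiv, e.surjective.range_comp]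

/-- If the classes of the vectors `v i` modulo the kernel of `π` are linearly independent, then a
vector of the kernel that is a combination of the `v i` and of a vector `y` of the kernel equals
`y`. -/
theorem mem_of_linearIndependent_comp {ι V M : Type*} [AddCommGroup V] [Module k V]
    [AddCommGroup M] [Module k M] {π : V →ₗ[k] M} {v : ι → V} (hv : LinearIndependent k (π ∘ v))
    {Y : Submodule k V} (hY : Y ≤ LinearMap.ker π) {h : V}
    (hh : h ∈ Submodule.span k (Set.range v) ⊔ Y) (h0 : π h = 0) : h ∈ Y := by
  obtain ⟨x, hx, y, hy, rfl⟩ := Submodule.mem_sup.1 hh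
  rw [map_add, LinearMap.mem_ker.1 (hY hy), add_zero] at h0
  have h1 := Submodule.disjoint_def.1 (Submodule.range_ker_disjoint hv) x hx h0
  rwa [h1, zero_add]

variable {X : Type v} [LinearOrder X] {S : Set (NCPoly k X)}

variable (S) in
/-- The quotient map `k⟨X⟩ → k⟨X | S⟩` as a linear map. -/
noncomputable def toEnvLinear : NCPoly k X →ₗ[k] Env S :=
  ((TwoSidedIdeal.span S).ringCon.mkₐ k).toLinearMap

omit [LinearOrder X] in
theorem toEnvLinear_eq_zero {f : NCPoly k X} :
    toEnvLinear S f = 0 ↔ f ∈ TwoSidedIdeal.span S := by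
  rw [TwoSidedIdeal.mem_iff]
  exact RingCon.eq _

omit [LinearOrder X] in
theorem toEnvLinear_surjective : Function.Surjective (toEnvLinear S) :=
  RingCon.mk'_surjective _

theorem multipleAt_mem_multiples {w : List X} (hw : w ∈ reducibleWords S) :
    multipleAt S w ∈ multiples S {w} := by
  obtain ⟨s, hs, a, b, rfl, e⟩ := multipleAt_spec hw
  rw [e]
  exact mul_mem_multiples hs rfl

theorem hasLead_multipleAt (hmonic : ∀ s ∈ S, IsMonic s) {w : List X}
    (hw : w ∈ reducibleWords S) : HasLead (multipleAt S w) w := by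
  obtain ⟨s, hs, a, b, rfl, e⟩ := multipleAt_spec hw
  rw [e]
  exact hasLead_mul_mul (hmonic s hs) a b

/-- Every polynomial is a combination of polynomials `e w` with `S`-irreducible `w` and of multiples
`a s b`. If the words of the polynomial lie in a set `Q` that is closed under passing to smaller
words, then only multiples with `a s̄ b ∈ Q` are needed. -/
theorem mem_span_sup_multiples [WellFoundedLT X] (hmonic : ∀ s ∈ S, IsMonic s)
    {e : List X → NCPoly k X} (he : ∀ w, HasLead (e w) w) {Q : Set (List X)}
    (hQ : ∀ u v, DegLexLT u v → v ∈ Q → u ∈ Q) {f : NCPoly k X} (hf : f ∈ wordSpan k Q) :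
    f ∈ Submodule.span k (Set.range fun w : {w : List X // IsIrr S w} => e w.1) ⊔
      multiples S Q := by
  classical
  have h := mem_span_of_isLeadingWord (A := ⊤) (P := Set.univ)
    (e := fun w => if w ∈ reducibleWords S then multipleAt S w else e w) (fun _ _ => trivial)
    ?_ (fun _ _ _ _ => trivial) hQ trivial hf
  · refine Submodule.span_le.2 ?_ h
    rintro _ ⟨w, ⟨-, hw⟩, rfl⟩
    by_cases hr : w ∈ reducibleWords S
    · simp only [hr, ↓reduceIte]
      exact Submodule.mem_sup_right (multiples_mono subset_rfl (Set.singleton_subset_iff.2 hw)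
        (multipleAt_mem_multiples hr))
    · simp only [hr, ↓reduceIte]
      exact Submodule.mem_sup_left
        (Submodule.subset_span ⟨⟨w, not_mem_reducibleWords.1 hr⟩, rfl⟩)
  · intro w _
    by_cases hr : w ∈ reducibleWords S
    · simp only [hr, ↓reduceIte]
      exact hasLead_multipleAt hmonic hr
    · simp only [hr, ↓reduceIte]
      exact he w

theorem multiples_le_ker (Q : Set (List X)) :
    multiples S Q ≤ LinearMap.ker (toEnvLinear S) := fun _ hf =>
  LinearMap.mem_ker.2 (toEnvLinear_eq_zero.2
    (mem_span_iff_mem_multiples.2 (multiples_mono subset_rfl (Set.subset_univ _) hf)))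

/-- Whatever monic polynomials `e w` with leading words `w` are chosen, `S` is a Gröbner–Shirshov
basis in `k⟨X⟩` if and only if the classes of the `e w`, for `S`-irreducible `w`, form a linear
basis of `k⟨X | S⟩`. -/
theorem isAssocGSBasis_iff_isLinearBasis [WellFoundedLT X] (hmonic : ∀ s ∈ S, IsMonic s)
    {e : List X → NCPoly k X} (he : ∀ w, HasLead (e w) w) :
    IsAssocGSBasis S ↔
      IsLinearBasis k fun w : {w : List X // IsIrr S w} => toEnv S (e w.1) := by
  constructor
  · intro hS
    constructor
    · refine LinearIndependent.map (f := toEnvLinear S)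
        (linearIndependent_of_hasLead Subtype.val_injective
          fun w : {w : List X // IsIrr S w} => he w.1) ?_
      rw [Submodule.disjoint_def]
      intro x hx hx0
      obtain ⟨c, rfl⟩ := Finsupp.mem_span_range_iff_exists_finsupp.1 hx
      rw [← Finsupp.linearCombination_apply] at hx0 ⊢
      by_cases hc : c = 0
      · rw [hc, map_zero]
      · exfalso
        obtain ⟨w, hw⟩ := exists_lead_of_mem_span Subtype.val_injective
          (fun w : {w : List X // IsIrr S w} => he w.1) hc
        exact not_mem_reducibleWords.2 w.2
          (hS.lead_mem hmonic (toEnvLinear_eq_zero.1 hx0) hw)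
    · rw [eq_top_iff]
      rintro y -
      obtain ⟨f, rfl⟩ := toEnvLinear_surjective y
      have h := mem_span_sup_multiples hmonic he (Q := Set.univ) (fun _ _ _ _ => trivial)
        (f := f) (wordSpan_univ.ge trivial)
      obtain ⟨x, hx, z, hz, rfl⟩ := Submodule.mem_sup.1 h
      rw [map_add, LinearMap.mem_ker.1 (multiples_le_ker _ hz), add_zero]
      have h1 := Submodule.mem_map_of_mem (f := toEnvLinear S) hx
      rwa [Submodule.map_span, ← Set.range_comp] at h1
  · intro hB
    have key : ∀ w h, h ∈ TwoSidedIdeal.span S → h ∈ lower k w → AssocTrivial S w h := by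
      intro w h hI hw
      refine mem_of_linearIndependent_comp (π := toEnvLinear S) hB.1
        (multiples_le_ker {v | DegLexLT v w}) ?_ (toEnvLinear_eq_zero.2 hI)
      exact mem_span_sup_multiples hmonic he (fun u v h h' => DegLexLT.trans h h') hw
    intro f hf g hg
    constructor
    · rintro w a b e1 e2 -
      refine key _ _ ?_ ?_
      · exact TwoSidedIdeal.sub_mem _
          (TwoSidedIdeal.mul_mem_right _ _ _ (TwoSidedIdeal.subset_span hf))
          (TwoSidedIdeal.mul_mem_left _ _ _ (TwoSidedIdeal.subset_span hg))
      · refine HasLead.sub_mem_lower ?_ ?_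
        · rw [e1]
          exact (hmonic f hf).hasLead.mul (hasLead_mono b)
        · rw [e2]
          exact (hasLead_mono a).mul (hmonic g hg).hasLead
    · rintro w a b rfl e2
      refine key _ _ ?_ ?_
      · exact TwoSidedIdeal.sub_mem _ (TwoSidedIdeal.subset_span hf)
          (TwoSidedIdeal.mul_mem_right _ _ _
            (TwoSidedIdeal.mul_mem_left _ _ _ (TwoSidedIdeal.subset_span hg)))
      · refine (hmonic f hf).hasLead.sub_mem_lower ?_
        rw [e2]
        exact hasLead_mul_mul (hmonic g hg) a b

/-- A product of Lyndon–Shirshov words `u₁ ⪯ ⋯ ⪯ uₙ` is `S`-irreducible if and only if its factors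
are: the words `s̄` are Lyndon–Shirshov words, hence cannot meet two factors. -/
theorem IsShirshovList.isIrr_flatten_iff (hLS : ∀ s ∈ S, IsALSW (lead s)) {c : List (List X)}
    (hc : IsShirshovList c) : IsIrr S c.flatten ↔ ∀ u ∈ c, IsIrr S u := by
  constructor
  · rintro h u hu s hs a b rfl
    obtain ⟨c₁, c₂, rfl⟩ := List.append_of_mem hu
    exact h s hs (c₁.flatten ++ a) (b ++ c₂.flatten) (by simp)
  · intro h s hs a b e
    obtain ⟨c₁, c₂, a', b', rfl, -, -⟩ := hc.exists_factor (hLS s hs) e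
    exact h _ (by simp) s hs a' b' rfl

variable (S) in
/-- The sequences `u₁ ⪯ ⋯ ⪯ uₙ` of `S`-irreducible Lyndon–Shirshov words correspond to the
`S`-irreducible words `u₁ ⋯ uₙ`. -/
noncomputable def irrSeqEquiv (hLS : ∀ s ∈ S, IsALSW (lead s)) :
    IrrSeq S ≃ {w : List X // IsIrr S w} where
  toFun c := ⟨c.1.flatten, (c.2.1.isIrr_flatten_iff hLS).2 c.2.2⟩
  invFun w := ⟨shirshovFactors w.1, (shirshovFactors_spec w.1).1,
    ((shirshovFactors_spec w.1).1.isIrr_flatten_iff hLS).1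
      ((shirshovFactors_spec w.1).2.symm ▸ w.2)⟩
  left_inv c := Subtype.ext ((shirshovFactors_spec c.1.flatten).1.flatten_inj c.2.1
    (shirshovFactors_spec c.1.flatten).2)
  right_inv w := Subtype.ext (shirshovFactors_spec w.1).2

theorem isAssocGSBasis_iff_isLinearBasis_irrSeq [WellFoundedLT X]
    (hmonic : ∀ s ∈ S, IsMonic s) (hLS : ∀ s ∈ S, IsALSW (lead s))
    {e : List X → NCPoly k X} (he : ∀ w, HasLead (e w) w) :
    IsAssocGSBasis S ↔ IsLinearBasis k fun c : IrrSeq S => toEnv S (e c.1.flatten) := by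
  rw [isAssocGSBasis_iff_isLinearBasis hmonic he,
    ← IsLinearBasis.comp_equiv_iff (irrSeqEquiv S hLS)]
  rfl

theorem hasLead_prod_lsBracket {c : List (List X)} (hc : ∀ u ∈ c, IsALSW u) :
    HasLead (c.map (lsBracket k)).prod c.flatten := by
  induction c with
  | nil => exact hasLead_mono (k := k) ([] : List X)
  | cons u c ih =>
    rw [List.map_cons, List.prod_cons, List.flatten_cons]
    exact (hasLead_lsBracket (hc u (by simp))).mul (ih fun v hv => hc v (by simp [hv]))

theorem isAssocGSBasis_iff_isLinearBasis_prod [WellFoundedLT X]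
    (hmonic : ∀ s ∈ S, IsMonic s) (hLS : ∀ s ∈ S, IsALSW (lead s)) :
    IsAssocGSBasis S ↔
      IsLinearBasis k fun c : IrrSeq S => toEnv S (c.1.map (lsBracket k)).prod := by
  have he : ∀ w : List X, HasLead ((shirshovFactors w).map (lsBracket k)).prod w := by
    intro w
    have h := shirshovFactors_spec w
    have := hasLead_prod_lsBracket (k := k) h.1.1
    rwa [h.2] at this
  rw [isAssocGSBasis_iff_isLinearBasis_irrSeq hmonic hLS he]
  have e : ∀ c : IrrSeq S, shirshovFactors c.1.flatten = c.1 := fun c =>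
    (shirshovFactors_spec c.1.flatten).1.flatten_inj c.2.1 (shirshovFactors_spec c.1.flatten).2
  simp only [e]

end Bases

/-! ### Linear bases of `Lie(X | S)` -/

section LieBases

variable {k : Type u} [Field k] {X : Type v} [LinearOrder X] {S : Set (NCPoly k X)}

open Classical in
variable (S) in
/-- For a Lyndon–Shirshov word `w`, a special normal word `[a s b]_{s̄}` with `a s̄ b = w` if there
is one, and the Lie monomial `[w]` otherwise. -/
noncomputable def normalAt (w : List X) : NCPoly k X :=
  if h : ∃ s ∈ S, ∃ a b : List X, w = a ++ lead s ++ b then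
    specialNormal h.choose_spec.2.choose h.choose h.choose_spec.2.choose_spec.choose
  else lsBracket k w

theorem normalAt_of_mem {w : List X} (hw : w ∈ reducibleWords S) :
    ∃ s ∈ S, ∃ a b : List X, w = a ++ lead s ++ b ∧ normalAt S w = specialNormal a s b := by
  have h : ∃ s ∈ S, ∃ a b : List X, w = a ++ lead s ++ b := hw
  refine ⟨h.choose, h.choose_spec.1, h.choose_spec.2.choose,
    h.choose_spec.2.choose_spec.choose, h.choose_spec.2.choose_spec.choose_spec, ?_⟩
  rw [normalAt, dif_pos h]

theorem normalAt_of_notMem {w : List X} (hw : w ∉ reducibleWords S) :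
    normalAt S w = lsBracket k w :=
  dif_neg hw

variable (S) in
/-- The quotient map `Lie(X) → Lie(X | S)` as a linear map. -/
noncomputable def toLieQuot : freeLie k X →ₗ[k] LieQuot S :=
  ((LieSubmodule.Quotient.mk' (lieIdeal S) : freeLie k X →ₗ⁅k, freeLie k X⁆ LieQuot S) :
    freeLie k X →ₗ[k] LieQuot S)

omit [LinearOrder X] in
theorem toLieQuot_eq_zero {x : freeLie k X} : toLieQuot S x = 0 ↔ x ∈ lieIdeal S :=
  LieSubmodule.Quotient.mk_eq_zero (lieIdeal S)

omit [LinearOrder X] in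
theorem toLieQuot_surjective : Function.Surjective (toLieQuot S) :=
  LieSubmodule.Quotient.surjective_mk' _

variable (k) in
/-- The Lie monomial `[w]` as an element of `Lie(X)`. -/
noncomputable def freeLieBracket (w : List X) : freeLie k X := ⟨lsBracket k w, lsBracket_mem w⟩

variable (S) in
/-- The linear combinations of normal words `(a s b)` with `a s̄ b ∈ Q`. -/
noncomputable def normalSpan (Q : Set (List X)) : Submodule k (NCPoly k X) :=
  Submodule.span k {p : NCPoly k X | ∃ s ∈ S, ∃ a b : List X,
    a ++ lead s ++ b ∈ Q ∧ IsNormalSWord s a b p}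

/-- Every Lie polynomial is a combination of Lie monomials `[w]` with `S`-irreducible `w` and of
normal words. -/
theorem mem_span_sup_normalSpan [WellFoundedLT X] (hLie : ∀ s ∈ S, s ∈ freeLie k X)
    (hmonic : ∀ s ∈ S, IsMonic s) {Q : Set (List X)}
    (hQ : ∀ u v, DegLexLT u v → v ∈ Q → u ∈ Q) {x : freeLie k X}
    (hx : (x : NCPoly k X) ∈ wordSpan k Q) :
    x ∈ Submodule.span k (Set.range fun w : IrrLS S => freeLieBracket k w.1) ⊔
      ((normalSpan S Q).comap (freeLie k X).toSubmodule.subtype ⊓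
        LinearMap.ker (toLieQuot S)) := by
  have hspec : ∀ w, IsALSW w → w ∈ reducibleWords S → ∃ s ∈ S, ∃ a b : List X,
      w = a ++ lead s ++ b ∧ HasLead (normalAt S w) w ∧ LieSWord s a b (normalAt S w) := by
    intro w hw hr
    obtain ⟨s, hs, a, b, rfl, e⟩ := normalAt_of_mem hr
    rw [e]
    exact ⟨s, hs, a, b, rfl,
      specialNormal_spec (hmonic s hs) (isALSW_lead (hLie s hs) (hmonic s hs)) hw⟩
  have h := mem_span_of_isLeadingWord (A := (freeLie k X).toSubmodule) (P := {w | IsALSW w})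
    (e := normalAt S) ?_ ?_ (fun f hf w hw => isALSW_of_isLeadingWord hf hw) hQ x.2 hx
  · set Y := Submodule.span k (Set.range fun w : IrrLS S => freeLieBracket k w.1) ⊔
      ((normalSpan S Q).comap (freeLie k X).toSubmodule.subtype ⊓
        LinearMap.ker (toLieQuot S)) with hY
    have hle : Submodule.span k (normalAt S '' ({w | IsALSW w} ∩ Q)) ≤
        Y.map (freeLie k X).toSubmodule.subtype := by
      refine Submodule.span_le.2 ?_
      rintro _ ⟨w, ⟨hw, hwQ⟩, rfl⟩
      by_cases hr : w ∈ reducibleWords S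
      · obtain ⟨s, hs, a, b, rfl, h1, h2⟩ := hspec w hw hr
        obtain ⟨y, hy, e⟩ := h2.exists_mem_lieIdeal hs (hLie s hs)
        refine ⟨y, Submodule.mem_sup_right ⟨?_, toLieQuot_eq_zero.2 hy⟩, e⟩
        rw [← e] at h1 h2
        exact Submodule.subset_span ⟨s, hs, a, b, hwQ, h2, h1.isLeadingWord⟩
      · refine ⟨freeLieBracket k w, Submodule.mem_sup_left (Submodule.subset_span
          ⟨⟨w, hw, not_mem_reducibleWords.1 hr⟩, rfl⟩), ?_⟩
        rw [normalAt_of_notMem hr]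
        rfl
    obtain ⟨y, hy, e⟩ := hle h
    obtain rfl : y = x := Subtype.ext e
    exact hy
  · intro w hw
    by_cases hr : w ∈ reducibleWords S
    · obtain ⟨s, hs, a, b, -, -, h⟩ := hspec w hw hr
      exact h.mem_freeLie (hLie s hs)
    · rw [normalAt_of_notMem hr]
      exact lsBracket_mem w
  · intro w hw
    by_cases hr : w ∈ reducibleWords S
    · obtain ⟨s, hs, a, b, -, h, -⟩ := hspec w hw hr
      exact h
    · rw [normalAt_of_notMem hr]
      exact hasLead_lsBracket hw

theorem IsAssocGSBasis.isLinearBasis_lieClass [WellFoundedLT X] (hS : IsAssocGSBasis S)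
    (hLie : ∀ s ∈ S, s ∈ freeLie k X) (hmonic : ∀ s ∈ S, IsMonic s) :
    IsLinearBasis k fun w : IrrLS S => lieClass S w.1 := by
  have hlead : ∀ w : IrrLS S, HasLead (lsBracket k w.1) w.1 := fun w => hasLead_lsBracket w.2.1
  constructor
  · have hind : LinearIndependent k fun w : IrrLS S => freeLieBracket k w.1 :=
      LinearIndependent.of_comp (freeLie k X).toSubmodule.subtype
        (linearIndependent_of_hasLead Subtype.val_injective hlead)
    refine LinearIndependent.map (f := toLieQuot S) hind ?_
    rw [Submodule.disjoint_def]
    intro x hx hx0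
    obtain ⟨c, rfl⟩ := Finsupp.mem_span_range_iff_exists_finsupp.1 hx
    rw [← Finsupp.linearCombination_apply] at hx0 ⊢
    by_cases hc : c = 0
    · rw [hc, map_zero]
    · exfalso
      obtain ⟨w, hw⟩ := exists_lead_of_mem_span Subtype.val_injective hlead hc
      have h1 := mem_span_of_mem_lieIdeal (toLieQuot_eq_zero.1 hx0)
      have h2 : ((Finsupp.linearCombination k (fun w : IrrLS S => freeLieBracket k w.1) c :
          freeLie k X) : NCPoly k X) =
          Finsupp.linearCombination k (fun w : IrrLS S => lsBracket k w.1) c :=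
        Finsupp.apply_linearCombination k (freeLie k X).toSubmodule.subtype
          (fun w : IrrLS S => freeLieBracket k w.1) c
      rw [h2] at h1
      exact not_mem_reducibleWords.2 w.2.2 (hS.lead_mem hmonic h1 hw)
  · rw [eq_top_iff]
    rintro y -
    obtain ⟨x, rfl⟩ := toLieQuot_surjective y
    have h := mem_span_sup_normalSpan hLie hmonic (Q := Set.univ) (fun _ _ _ _ => trivial)
      (x := x) (wordSpan_univ.ge trivial)
    obtain ⟨x, hx, z, hz, rfl⟩ := Submodule.mem_sup.1 h
    rw [map_add, LinearMap.mem_ker.1 hz.2, add_zero]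
    have h1 := Submodule.mem_map_of_mem (f := toLieQuot S) hx
    rwa [Submodule.map_span, ← Set.range_comp] at h1

/-- The word `w = f̄ b = a ḡ` of an intersection composition is a Lyndon–Shirshov word. -/
theorem isALSW_of_overlap {u v w a b : List X} (hu : IsALSW u) (hv : IsALSW v)
    (e1 : w = u ++ b) (e2 : w = a ++ v) (hl : w.length < u.length + v.length) : IsALSW w := by
  subst e1
  rcases List.append_eq_append_iff.1 e2 with ⟨t, rfl, rfl⟩ | ⟨t, rfl, rfl⟩
  · simp only [List.length_append] at hl
    omega
  · refine hu.overlap hv ?_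
    rintro rfl
    simp at hl

theorem isLieGSBasis_of_isLinearBasis_lieClass [WellFoundedLT X]
    (hLie : ∀ s ∈ S, s ∈ freeLie k X) (hmonic : ∀ s ∈ S, IsMonic s)
    (hB : IsLinearBasis k fun w : IrrLS S => lieClass S w.1) : IsLieGSBasis S := by
  have hLS : ∀ s ∈ S, IsALSW (lead s) := fun s hs => isALSW_lead (hLie s hs) (hmonic s hs)
  have key : ∀ (w : List X) (x : freeLie k X), x ∈ lieIdeal S → (x : NCPoly k X) ∈ lower k w →
      LieTrivial S w x := by
    intro w x hx hw
    have h := mem_of_linearIndependent_comp (π := toLieQuot S) hB.1 inf_le_right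
      (mem_span_sup_normalSpan hLie hmonic (Q := {v | DegLexLT v w})
        (fun u v h h' => DegLexLT.trans h h') hw) (toLieQuot_eq_zero.2 hx)
    exact h.1
  intro f hf g hg
  constructor
  · intro w a b e1 e2 hl
    have hw := isALSW_of_overlap (hLS f hf) (hLS g hg) e1 e2 hl
    obtain ⟨h1, h2⟩ := specialNormal_spec (a := []) (b := b) (hmonic f hf) (hLS f hf)
      (by simpa [← e1] using hw)
    obtain ⟨h3, h4⟩ := specialNormal_spec (a := a) (b := []) (hmonic g hg) (hLS g hg)
      (by simpa [← e2] using hw)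
    rw [List.nil_append, ← e1] at h1
    rw [List.append_nil, ← e2] at h3
    obtain ⟨x, hx, ex⟩ := h2.exists_mem_lieIdeal hf (hLie f hf)
    obtain ⟨y, hy, ey⟩ := h4.exists_mem_lieIdeal hg (hLie g hg)
    rw [← ex] at h1 ⊢
    rw [← ey] at h3 ⊢
    exact key w (x - y) (sub_mem hx hy) (h1.sub_mem_lower h3)
  · rintro w a b rfl e2
    have hw := hLS f hf
    obtain ⟨h3, h4⟩ := specialNormal_spec (a := a) (b := b) (hmonic g hg) (hLS g hg)
      (by rwa [← e2])
    rw [← e2] at h3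
    obtain ⟨x, hx, ex⟩ := (LieSWord.base (s := f)).exists_mem_lieIdeal hf (hLie f hf)
    obtain ⟨y, hy, ey⟩ := h4.exists_mem_lieIdeal hg (hLie g hg)
    have h1 := (hmonic f hf).hasLead
    have h5 : (x : NCPoly k X) - y ∈ lower k (lead f) := by
      rw [ex, ey]
      exact h1.sub_mem_lower h3
    have h6 := key (lead f) (x - y) (sub_mem hx hy) h5
    have h7 : ((x - y : freeLie k X) : NCPoly k X) = f - specialNormal a g b := by
      rw [← ex, ← ey]
      rfl
    rwa [h7] at h6

/-- An element of the ideal generated by a single `s ∈ S` all of whose words are smaller than `w` is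
trivial modulo `w`. -/
theorem assocTrivial_of_mem_span_singleton [WellFoundedLT X] {s : NCPoly k X} (hs : s ∈ S)
    (hm : IsMonic s) (hLS : IsALSW (lead s)) {h : NCPoly k X}
    (hh : h ∈ TwoSidedIdeal.span {s}) {w : List X} (hw : h ∈ lower k w) : AssocTrivial S w h :=
  AssocTrivial.of_subset (Set.singleton_subset_iff.2 hs)
    ((isAssocGSBasis_singleton hLS).assocTrivial (by rintro _ rfl; exact hm) hh hw)

theorem IsLieGSBasis.isAssocGSBasis [WellFoundedLT X] (hS : IsLieGSBasis S)
    (hLie : ∀ s ∈ S, s ∈ freeLie k X) (hmonic : ∀ s ∈ S, IsMonic s) : IsAssocGSBasis S := by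
  have hLS : ∀ s ∈ S, IsALSW (lead s) := fun s hs => isALSW_lead (hLie s hs) (hmonic s hs)
  have htriv : ∀ {w : List X} {h : NCPoly k X}, LieTrivial S w h → AssocTrivial S w h := by
    intro w h hh
    refine Submodule.span_le.2 ?_ hh
    rintro p ⟨s, hs, a, b, hab, hp, hpw⟩
    refine assocTrivial_of_mem_span_singleton hs (hmonic s hs) (hLS s hs) hp.mem_span ?_
    refine mem_wordSpan.2 fun v hv => ?_
    rcases hpw.2 v hv with rfl | h
    · exact hab
    · exact h.trans hab
  -- a special normal word differs from the multiple `a s b` by smaller multiples of `s`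
  have hnormal : ∀ s ∈ S, ∀ a b : List X, IsALSW (a ++ lead s ++ b) →
      AssocTrivial S (a ++ lead s ++ b) (mono k a * s * mono k b - specialNormal a s b) := by
    intro s hs a b hw
    obtain ⟨h1, h2⟩ := specialNormal_spec (hmonic s hs) (hLS s hs) hw
    refine assocTrivial_of_mem_span_singleton hs (hmonic s hs) (hLS s hs) ?_
      ((hasLead_mul_mul (hmonic s hs) a b).sub_mem_lower h1)
    exact TwoSidedIdeal.sub_mem _ (TwoSidedIdeal.mul_mem_right _ _ _
      (TwoSidedIdeal.mul_mem_left _ _ _ (TwoSidedIdeal.subset_span rfl))) h2.mem_span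
  intro f hf g hg
  constructor
  · intro w a b e1 e2 hl
    have hw := isALSW_of_overlap (hLS f hf) (hLS g hg) e1 e2 hl
    have h1 := hnormal f hf [] b (by simpa [← e1] using hw)
    have h2 := hnormal g hg a [] (by simpa [← e2] using hw)
    rw [List.nil_append, ← e1, mono_nil, one_mul] at h1
    rw [List.append_nil, ← e2, mono_nil, mul_one] at h2
    have h3 := htriv ((hS f hf g hg).1 w a b e1 e2 hl)
    have h4 := Submodule.add_mem _ (Submodule.sub_mem _ h1 h2) h3
    have e : f * mono k b - specialNormal [] f b - (mono k a * g - specialNormal a g []) +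
        (specialNormal [] f b - specialNormal a g []) = f * mono k b - mono k a * g := by abel
    rwa [e] at h4
  · intro w a b e1 e2
    have h2 := hnormal g hg a b (by rw [← e2, e1]; exact hLS f hf)
    rw [← e2] at h2
    have h3 := htriv ((hS f hf g hg).2 w a b e1 e2)
    have h4 := Submodule.sub_mem _ h3 h2
    have e : f - specialNormal a g b - (mono k a * g * mono k b - specialNormal a g b) =
        f - mono k a * g * mono k b := by abel
    rwa [e] at h4

end LieBases

end GSLie

theorem theorem4p10 {k : Type u} [Field k] {X : Type v} [LinearOrder X] [WellFoundedLT X]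
    (S : Set (GSLie.NCPoly k X)) (hLie : ∀ s ∈ S, s ∈ GSLie.freeLie k X)
    (hmonic : ∀ s ∈ S, GSLie.IsMonic s) :
    (GSLie.IsLieGSBasis S ↔ GSLie.IsAssocGSBasis S) ∧
    [GSLie.IsLieGSBasis S,
      GSLie.IsAssocGSBasis S,
      GSLie.IsLinearBasis k
        (fun c : GSLie.IrrSeq S => GSLie.toEnv S (GSLie.mono k c.1.flatten)),
      GSLie.IsLinearBasis k
        (fun w : GSLie.IrrLS S => GSLie.lieClass S w.1),
      GSLie.IsLinearBasis k
        (fun c : GSLie.IrrSeq S =>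
          GSLie.toEnv S (c.1.map (GSLie.lsBracket k)).prod)].TFAE := by
  have hLS : ∀ s ∈ S, GSLie.IsALSW (GSLie.lead s) := fun s hs =>
    GSLie.isALSW_lead (hLie s hs) (hmonic s hs)
  have h12 : GSLie.IsLieGSBasis S → GSLie.IsAssocGSBasis S := fun h =>
    h.isAssocGSBasis hLie hmonic
  have h24 : GSLie.IsAssocGSBasis S →
      GSLie.IsLinearBasis k (fun w : GSLie.IrrLS S => GSLie.lieClass S w.1) := fun h =>
    h.isLinearBasis_lieClass hLie hmonic
  have h41 : GSLie.IsLinearBasis k (fun w : GSLie.IrrLS S => GSLie.lieClass S w.1) →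
      GSLie.IsLieGSBasis S :=
    GSLie.isLieGSBasis_of_isLinearBasis_lieClass hLie hmonic
  have h23 := GSLie.isAssocGSBasis_iff_isLinearBasis_irrSeq hmonic hLS
    (GSLie.hasLead_mono (k := k) (X := X))
  have h25 := GSLie.isAssocGSBasis_iff_isLinearBasis_prod hmonic hLS
  refine ⟨⟨h12, fun h => h41 (h24 h)⟩, ?_⟩
  tfae_have 1 → 2 := h12
  tfae_have 2 → 4 := h24
  tfae_have 4 → 1 := h41
  tfae_have 2 ↔ 3 := h23
  tfae_have 2 ↔ 5 := h25
  tfae_finish
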